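/- Let $M$ be a $W^*$-algebra and $p_0\in M$ an orthogonal projection. For $x\in M$ let $l(x)$, $r(x)$ be its left and right supports; $x$ is partially invertible if $|x|=(x^*x)^{1/2}$ is invertible in $pMp$, where $p$ is the support of $|x|$. Let $L=L_{p_0}(M)=\{l(x): x \text{ partially invertible},\ r(x)=p_0\}$, let $G=G_{p_0}(M)\rightrightarrows L$ be the groupoid of the partially invertible $x$ with $l(x),r(x)\in L$ (target $l$, source $r$, product of $M$), and let $U=U_{p_0}(M)\subset G$ be the subgroupoid of partial isometries. For $p\in L$ let $\Pi_p$ be the set of projections $q$ with $M=qM\oplus(1-p)M$, and let $\varphi_p:\Pi_p\to(1-p)Mp$ be given by the decomposition $p=(p+\varphi_p(q))-\varphi_p(q)$ of $p$ in $qM\oplus(1-p)M$. The algebroid $A=A_{p_0}(M)\to L$ has as fibre $A_q$ at $q\in L$ the tangent space at the unit $q$ to the source fibre $r^{-1}(q)\subset Mq$ of $G$; a section $X$ defines the right-invariant vector fields $\eta\mapsto X(l(\eta))\eta$ on the source fibres (open in the Banach spaces $Mq$), the bracket $[X,Y]$ of sections is the value at the units of the Lie bracket of these fields, and the anchor $\mathbf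 a$ is the tangent map $Tl$ at the units. Over $\Pi_p$, at the point $q=\varphi_p^{-1}(y)=l(p+y)$, $A$ is trivialized by $x\mapsto (a_p,b_p)=\big((1-(p+y))x(p+y),\ p\,x\,(p+y)\big)\in (1-p)Mp\oplus pMp$. The algebroid $A^u=A^u_{p_0}(M)$ is defined in the same way from $U$: its fibre at $q$ is the space of velocities at $q$ of smooth curves in $U\cap r^{-1}(q)$. Sections are smooth ($C^\infty$ over $\mathbb R$). Then the $(\Pi_p,\varphi_p)$, $p\in L$, form a smooth atlas of $L$ with $\varphi_p^{-1}(y)=l(p+y)$, the maps above make $A$ a real Banach vector bundle, $A$ is a Lie algebroid over $L$, and $A^u$ is a transitive subalgebroid of $A$: 1. $A^u$ is a real Banach subbundle of $A$: over every $\Pi_p$ a smooth change of the trivialization carries the fibres of $A^u$ onto one fixed closed complemented real subspace. 2. If $X,Y$ are smooth sections of $A^u$, so is $[X,Y]$; with this bracket and the restricted anchor $A^u$ is a Lie algebroid (bilinearity, antisymmetry, Jacobi identity, Leibniz rule, anchor a bracket homomorphism), and this bracket is the one of the algebroid of $U$. 3. The anchor maps every fibre $A^u_q$ onto $T_qL$,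 with a bounded linear right inverse. 4. The anchor of $A^u$ is the restriction of $Tl$. In the chart $\varphi_p$ it maps a section $X$ to the smooth real vector field with component $a_p(y)=(1-(p+y))\,X(q)\,(p+y)$, $q=\varphi_p^{-1}(y)$, that is, $\mathbf a(X)=\langle\partial/\partial y,a_p\rangle+\langle\partial/\partial y^*,a_p^*\rangle$. Moreover, put $P_0=\{\eta\in G: r(\eta)=p_0\}$ and $P_0^u=P_0\cap U$. For $\eta\in P_0$ the map $x\mapsto x\eta$ is a bijection of $A_{l(\eta)}$ onto $T_\eta P_0$, and for $\eta\in P_0^u$ it is a bijection of $A^u_{l(\eta)}$ onto $T_\eta P^u_0$ (so that $A\cong TP_0/G_0$ and $A^u\cong TP_0^u/U_0$, with $G_0$ and $U_0$ the invertible and the unitary elements of $p_0Mp_0$). Under it the bracket of $A$ is the Lie bracket of the invariant vector fields on $P_0$, and the anchor is the tangent map of $l:P_0\to L$. -/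

import Mathlib

open scoped ContDiff Topology

namespace WStarGroupoid

noncomputable section

variable {M : Type*} [CStarAlgebra M]

/-! ### Projections, supports and the spaces `qM`, `Mq`, `(1-p)Mp`, `pMp` -/

variable (M) in
/-- The set of orthogonal projections of the algebra `M`. -/
abbrev Proj : Type _ := {p : M // IsStarProjection p}

/-- The right ideal `eM`, as a real vector space. -/
def rightIdeal (e : M) : Submodule ℝ M where
  carrier := {x | e * x = x}
  add_mem' := by
    intro a b ha hb
    simp only [Set.mem_ofPred_eq] at *
    rw [mul_add, ha, hb]
  zero_mem' := by simp
  smul_mem' := by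
    intro c x hx
    simp only [Set.mem_ofPred_eq] at *
    rw [mul_smul_comm, hx]

/-- The left ideal `Mq`, as a real Banach space. -/
def leftIdeal (q : Proj M) : Submodule ℝ M where
  carrier := {x | x * q = x}
  add_mem' := by
    intro a b ha hb
    simp only [Set.mem_ofPred_eq] at *
    rw [add_mul, ha, hb]
  zero_mem' := by simp
  smul_mem' := by
    intro c x hx
    simp only [Set.mem_ofPred_eq] at *
    rw [smul_mul_assoc, hx]

/-- The space `(1-p)Mp`, as a real Banach space; the model space of the base at `p`. -/
def chartSpace (p : Proj M) : Submodule ℝ M :=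
  rightIdeal (1 - (p : M)) ⊓ leftIdeal p

/-- The space `pMp`, as a real Banach space. -/
def corner (p : Proj M) : Submodule ℝ M :=
  rightIdeal (p : M) ⊓ leftIdeal p

/-- `q` is the right support of `x`: the least projection with `x q = x`
(for projections, `q ≤ q'` means `q q' = q`). -/
def IsRightSupport (x : M) (q : Proj M) : Prop :=
  x * q = x ∧ ∀ q' : Proj M, x * q' = x → (q : M) * q' = q

/-- `q` is the left support of `x`: the least projection with `q x = x`. -/
def IsLeftSupport (x : M) (q : Proj M) : Prop :=
  (q : M) * x = x ∧ ∀ q' : Proj M, (q' : M) * x = x → (q : M) * q' = q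

open Classical in
/-- The right support `r(x)` (it always exists in a `W*`-algebra, and it is unique). -/
def rsupp (x : M) : Proj M :=
  if h : ∃ q, IsRightSupport x q then h.choose else ⟨0, .zero M⟩

open Classical in
/-- The left support `l(x)` (it always exists in a `W*`-algebra, and it is unique). -/
def lsupp (x : M) : Proj M :=
  if h : ∃ q, IsLeftSupport x q then h.choose else ⟨0, .zero M⟩

/-! ### The groupoids -/

/-- `x` is partially invertible: `|x|` is an invertible element of `pMp`, where `p` is the
support of `|x|`. -/
def IsPartiallyInvertible [PartialOrder M] [StarOrderedRing M] (x : M) : Prop :=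
  ∃ p : Proj M, IsRightSupport (CFC.abs x) p ∧
    ∃ k ∈ corner p, CFC.abs x * k = p ∧ k * CFC.abs x = p

/-- The orbit `L_{p₀}(M)` of `p₀`: left supports of the partially invertible elements with
right support `p₀`. -/
def orbit [PartialOrder M] [StarOrderedRing M] (p₀ : Proj M) : Set (Proj M) :=
  {q | ∃ x : M, IsPartiallyInvertible x ∧ rsupp x = p₀ ∧ lsupp x = q}

/-- The (arrows of the) groupoid `G_{p₀}(M)`, with source map `r`, target map `l`, and the
product of `M` as partial multiplication. -/
def groupoidG [PartialOrder M] [StarOrderedRing M] (p₀ : Proj M) : Set M :=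
  {x | IsPartiallyInvertible x ∧ lsupp x ∈ orbit p₀ ∧ rsupp x ∈ orbit p₀}

/-- The (arrows of the) subgroupoid `U_{p₀}(M)` of partial isometries. -/
def groupoidU [PartialOrder M] [StarOrderedRing M] (p₀ : Proj M) : Set M :=
  {x | x ∈ groupoidG p₀ ∧ x * star x * x = x}

/-- The source fibre `r⁻¹(q)` of a groupoid `𝒢 ⊆ M`, as a subset of the Banach space `Mq`.
For `q = p₀` and `𝒢 = groupoidG p₀`, `groupoidU p₀` these are the total spaces `P₀`, `P₀ᵘ` of
the principal bundles over `L_{p₀}(M)`. -/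
def sourceFibre (𝒢 : Set M) (q : Proj M) : Set (leftIdeal q) :=
  {η | (η : M) ∈ 𝒢 ∧ rsupp (η : M) = q}

/-- The unit arrow of the groupoid at `q`, which is the projection `q` itself. -/
def unit (q : Proj M) : leftIdeal q := ⟨q, q.2.isIdempotentElem⟩

/-- `γ` is a smooth curve in `S`, defined near `0`, with `γ(0) = η` and velocity `v` at `0`. -/
def IsCurveIn {E : Type*} [NormedAddCommGroup E] [NormedSpace ℝ E]
    (S : Set E) (η v : E) (γ : ℝ → E) : Prop :=
  ContDiffAt ℝ ∞ γ 0 ∧ γ 0 = η ∧ (∀ᶠ t in 𝓝 0, γ t ∈ S) ∧ HasDerivAt γ v 0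

/-- The tangent vectors at `η` to a subset `S` of a Banach space: velocities of smooth curves. -/
def tangentSet {E : Type*} [NormedAddCommGroup E] [NormedSpace ℝ E] (S : Set E) (η : E) : Set E :=
  {v | ∃ γ, IsCurveIn S η v γ}

/-- The fibre at `q` of the Lie algebroid of a groupoid `𝒢 ⊆ M`: the tangent space at the unit
`q` to the source fibre `r⁻¹(q)`. -/
def algebroidFibre (𝒢 : Set M) (q : Proj M) : Set (leftIdeal q) :=
  tangentSet (sourceFibre 𝒢 q) (unit q)

/-- The fibres of the algebroid `A_{p₀}(M)` of `G_{p₀}(M)`. -/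
def algA [PartialOrder M] [StarOrderedRing M] (p₀ q : Proj M) : Set (leftIdeal q) :=
  algebroidFibre (groupoidG p₀) q

/-- The fibres of the algebroid `Aᵘ_{p₀}(M)` of `U_{p₀}(M)`. -/
def algU [PartialOrder M] [StarOrderedRing M] (p₀ q : Proj M) : Set (leftIdeal q) :=
  algebroidFibre (groupoidU p₀) q

/-! ### Charts of the base -/

/-- The chart domain `Π_p`: projections `q` with `M = qM ⊕ (1-p)M`. -/
def chartDom (p : Proj M) : Set (Proj M) :=
  {q | IsCompl (rightIdeal (q : M)) (rightIdeal (1 - (p : M)))}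

open Classical in
/-- The chart `φ_p : Π_p → (1-p)Mp`: for `q ∈ Π_p`, the decomposition of `p` along
`M = qM ⊕ (1-p)M` is `p = (p + φ_p(q)) - φ_p(q)`. Outside `Π_p` the value is irrelevant. -/
def chart (p q : Proj M) : chartSpace p :=
  if h : q ∈ chartDom p ∧ ∃ y : chartSpace p, (p : M) + y ∈ rightIdeal (q : M) then
    h.2.choose else 0

/-- The inverse chart `y ↦ l(p + y)`. -/
def chartInv (p : Proj M) (y : chartSpace p) : Proj M := lsupp ((p : M) + y)

/-- The maps `φ_p : Π_p → (1-p)Mp`, `p ∈ L_{p₀}(M)`, are bijections with inverses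
`y ↦ l(p + y)`, and they form a smooth atlas of `L_{p₀}(M)`. -/
def IsBaseAtlas [PartialOrder M] [StarOrderedRing M] (p₀ : Proj M) : Prop :=
  ∀ p ∈ orbit p₀,
    (p ∈ chartDom p ∧ chartDom p ⊆ orbit p₀) ∧
    (∀ y, chartInv p y ∈ chartDom p ∧ chart p (chartInv p y) = y) ∧
    (∀ q ∈ chartDom p, chartInv p (chart p q) = q) ∧
    ∀ p' ∈ orbit p₀, IsOpen {y | chartInv p y ∈ chartDom p'} ∧
      ContDiffOn ℝ ∞ (fun y => chart p' (chartInv p y)) {y | chartInv p y ∈ chartDom p'}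

/-- Smoothness of a function on `L_{p₀}(M)`, in charts. -/
def IsSmoothOnBase [PartialOrder M] [StarOrderedRing M] (p₀ : Proj M) (f : Proj M → ℝ) : Prop :=
  ∀ p ∈ orbit p₀, ContDiff ℝ ∞ (fun y => f (chartInv p y))

/-! ### Charts of the bundle -/

lemma mul_chart (p : Proj M) (y : chartSpace p) : (p : M) * y = 0 := by
  have h : (1 - (p : M)) * y = y := y.2.1
  rw [sub_mul, one_mul] at h
  simpa using h

lemma chart_mul (p : Proj M) (y : chartSpace p) : (y : M) * p = y := y.2.2

lemma sigma_mul (p : Proj M) (y : chartSpace p) : ((p : M) + y) * p = p + y := by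
  rw [add_mul, p.2.isIdempotentElem, chart_mul]

lemma mul_sigma (p : Proj M) (y : chartSpace p) : (p : M) * (p + y) = p := by
  rw [mul_add, p.2.isIdempotentElem, mul_chart, add_zero]

/-- The model space `(1-p)Mp ⊕ pMp` of the fibres over `Π_p`. -/
abbrev Model (p : Proj M) : Type _ := chartSpace p × corner p

/-- The first coordinate `a_p = (1 - (p+y)) x (p+y)` of a vector `x` of the fibre over the
point `q = φ_p⁻¹(y)`. In the coordinates `y_p = φ_p(l(η))`, `z_p = pη` of `η ∈ P₀`, the tangent
vector `ϑ = xη` has components `(a_p, b_p z_p)`. -/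
def coordA (p : Proj M) (y : chartSpace p) (x : M) : chartSpace p :=
  ⟨(1 - ((p : M) + y)) * x * (p + y), by
    refine ⟨?_, ?_⟩
    · change (1 - (p : M)) * _ = _
      rw [← mul_assoc, ← mul_assoc]
      congr 2
      rw [sub_mul, one_mul, mul_sub, mul_one, mul_sigma, sub_self, sub_zero]
    · change _ * (p : M) = _
      rw [mul_assoc, sigma_mul]⟩

/-- The second coordinate `b_p = p x (p+y)` of a vector of the fibre over `φ_p⁻¹(y)`. -/
def coordB (p : Proj M) (y : chartSpace p) (x : M) : corner p :=
  ⟨(p : M) * x * (p + y), by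
    refine ⟨?_, ?_⟩
    · change (p : M) * _ = _
      rw [← mul_assoc, ← mul_assoc, p.2.isIdempotentElem]
    · change _ * (p : M) = _
      rw [mul_assoc, sigma_mul]⟩

/-- The bundle chart of `A_{p₀}(M)` over `Π_p`, on the fibre over `φ_p⁻¹(y)`. -/
def bundleCoord (p : Proj M) (y : chartSpace p) (x : M) : Model p :=
  (coordA p y x, coordB p y x)

/-- The family `E` of fibres is a real Banach vector bundle over `L_{p₀}(M)` with the bundle
charts `bundleCoord`: they are fibrewise bijective onto the model spaces (each of them is
additive and real homogeneous), and the transition maps are smooth families of bounded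
operators. -/
def IsBanachBundle [PartialOrder M] [StarOrderedRing M] (p₀ : Proj M)
    (E : ∀ q : Proj M, Set (leftIdeal q)) : Prop :=
  ∀ p ∈ orbit p₀,
    (∀ y, Set.BijOn (fun x : leftIdeal (chartInv p y) => bundleCoord p y x)
      (E (chartInv p y)) Set.univ) ∧
    ∀ p' ∈ orbit p₀, ∃ g : chartSpace p → (Model p →L[ℝ] Model p'),
      ContDiffOn ℝ ∞ g {y | chartInv p y ∈ chartDom p'} ∧
      ∀ y, chartInv p y ∈ chartDom p' → ∀ x ∈ E (chartInv p y),
        g y (bundleCoord p y x) = bundleCoord p' (chart p' (chartInv p y)) x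

/-- `F` is a real Banach subbundle of `E`: over each `Π_p` a smooth change of the bundle chart
of `E` carries the fibres of `F` onto one closed complemented real subspace of the model. -/
def IsBanachSubbundle [PartialOrder M] [StarOrderedRing M] (p₀ : Proj M)
    (E F : ∀ q : Proj M, Set (leftIdeal q)) : Prop :=
  (∀ q ∈ orbit p₀, F q ⊆ E q) ∧
  ∀ p ∈ orbit p₀, ∃ (K : Submodule ℝ (Model p)) (T : chartSpace p → (Model p ≃L[ℝ] Model p)),
    K.ClosedComplemented ∧
    ContDiff ℝ ∞ (fun y => (T y : Model p →L[ℝ] Model p)) ∧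
    ContDiff ℝ ∞ (fun y => ((T y).symm : Model p →L[ℝ] Model p)) ∧
    ∀ y, F (chartInv p y) = {x ∈ E (chartInv p y) | T y (bundleCoord p y x) ∈ K}

/-! ### Sections, bracket and anchor -/

/-- `X` is a smooth section over `L_{p₀}(M)` with values in the fibres `E`. Only the values of `X`
on `L_{p₀}(M)` matter. -/
def IsSection [PartialOrder M] [StarOrderedRing M] (p₀ : Proj M)
    (E : ∀ q : Proj M, Set (leftIdeal q)) (X : ∀ q : Proj M, leftIdeal q) : Prop :=
  (∀ q ∈ orbit p₀, X q ∈ E q) ∧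
  ∀ p ∈ orbit p₀, ContDiff ℝ ∞ (fun y => bundleCoord p y (X (chartInv p y)))

/-- The product `xη ∈ Me` of `x ∈ Mq` and `η ∈ Me`. -/
def rightTranslate {e q : Proj M} (η : leftIdeal e) (x : leftIdeal q) : leftIdeal e :=
  ⟨(x : M) * η, by
    change (x : M) * η * e = x * η
    rw [mul_assoc, show (η : M) * e = η from η.2]⟩

/-- The right-invariant vector field `η ↦ X(l(η)) η` on the source fibre `r⁻¹(e)`, an open subset
of `Me`, defined by a section `X`. -/
def rightInv (e : Proj M) (X : ∀ q : Proj M, leftIdeal q) : leftIdeal e → leftIdeal e :=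
  fun η => rightTranslate η (X (lsupp (η : M)))

/-- The algebroid bracket: the value at the unit `q` of the Lie bracket of the right-invariant
vector fields on `r⁻¹(q)` defined by `X` and `Y`. -/
def bracket (X Y : ∀ q : Proj M, leftIdeal q) (q : Proj M) : leftIdeal q :=
  VectorField.lieBracket ℝ (rightInv q X) (rightInv q Y) (unit q)

/-- The anchor at `q`, in the chart `φ_p`: the tangent map at the unit `q` of the left support
`l : r⁻¹(q) → L_{p₀}(M)`. Tangent vectors of the base at a point of `Π_p` are represented in the
chart `φ_p` by elements of `(1-p)Mp`. -/
def anchor (p q : Proj M) : leftIdeal q →L[ℝ] chartSpace p :=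
  fderiv ℝ (fun η : leftIdeal q => chart p (lsupp (η : M))) (unit q)

/-- The vector field `a(X)` on the base, in the chart `φ_p`. -/
def anchorField (p : Proj M) (X : ∀ q : Proj M, leftIdeal q) : chartSpace p → chartSpace p :=
  fun y => anchor p (chartInv p y) (X (chartInv p y))

/-- The bundle `E` of subspaces, with the bracket and the anchor above, is a Lie algebroid over
`L_{p₀}(M)`. -/
structure IsLieAlgebroid [PartialOrder M] [StarOrderedRing M] (p₀ : Proj M)
    (E : ∀ q : Proj M, Set (leftIdeal q)) : Prop where
  add_mem : ∀ X Y, IsSection p₀ E X → IsSection p₀ E Y → IsSection p₀ E (X + Y)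
  smul_mem : ∀ f X, IsSmoothOnBase p₀ f → IsSection p₀ E X →
    IsSection p₀ E (fun q => f q • X q)
  bracket_mem : ∀ X Y, IsSection p₀ E X → IsSection p₀ E Y → IsSection p₀ E (bracket X Y)
  bracket_add : ∀ X Y Z, IsSection p₀ E X → IsSection p₀ E Y → IsSection p₀ E Z →
    ∀ q ∈ orbit p₀, bracket X (Y + Z) q = bracket X Y q + bracket X Z q
  bracket_smul : ∀ (c : ℝ) X Y, IsSection p₀ E X → IsSection p₀ E Y →
    ∀ q ∈ orbit p₀, bracket X (c • Y) q = c • bracket X Y q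
  bracket_swap : ∀ X Y, IsSection p₀ E X → IsSection p₀ E Y →
    ∀ q ∈ orbit p₀, bracket X Y q = -bracket Y X q
  jacobi : ∀ X Y Z, IsSection p₀ E X → IsSection p₀ E Y → IsSection p₀ E Z →
    ∀ q ∈ orbit p₀,
      bracket X (bracket Y Z) q + bracket Y (bracket Z X) q + bracket Z (bracket X Y) q = 0
  leibniz : ∀ f X Y, IsSmoothOnBase p₀ f → IsSection p₀ E X → IsSection p₀ E Y →
    ∀ p ∈ orbit p₀, ∀ y : chartSpace p,
      bracket X (fun q => f q • Y q) (chartInv p y) =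
        f (chartInv p y) • bracket X Y (chartInv p y) +
          fderiv ℝ (fun y' => f (chartInv p y')) y (anchorField p X y) • Y (chartInv p y)
  anchor_bracket : ∀ X Y, IsSection p₀ E X → IsSection p₀ E Y →
    ∀ p ∈ orbit p₀, ∀ y : chartSpace p,
      anchorField p (bracket X Y) y =
        VectorField.lieBracket ℝ (anchorField p X) (anchorField p Y) y

/-- Transitivity: the anchor is fibrewise surjective onto the tangent space of the base, with
complemented kernel; in other words, it has a bounded linear right inverse into the fibre. -/
def IsTransitive [PartialOrder M] [StarOrderedRing M] (p₀ : Proj M)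
    (E : ∀ q : Proj M, Set (leftIdeal q)) : Prop :=
  ∀ p ∈ orbit p₀, ∀ q ∈ chartDom p, ∃ s : chartSpace p →L[ℝ] leftIdeal q,
    ∀ v, s v ∈ E q ∧ anchor p q (s v) = v

/-- `v` represents, in the chart `φ_p`, the image of `x` under the anchor of the algebroid of the
groupoid `𝒢 ⊆ M`: the derivative of `l` along every curve in the source fibre `r⁻¹(q) ∩ 𝒢` with
velocity `x` at the unit. -/
def IsAnchorOf (𝒢 : Set M) (p q : Proj M) (x : leftIdeal q) (v : chartSpace p) : Prop :=
  ∀ γ, IsCurveIn (sourceFibre 𝒢 q) (unit q) x γ →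
    HasDerivAt (fun t => chart p (lsupp (γ t : M))) v 0

/-- `z` is the value at `q` of the bracket of `X`, `Y` in the algebroid of the groupoid `𝒢 ⊆ M`:
the Lie bracket at the unit of the right-invariant vector fields of the submanifold
`r⁻¹(q) ∩ 𝒢` of `Mq`, that is, the derivative of the second field along a curve in the submanifold
tangent to the first, minus the derivative of the first along a curve tangent to the second. -/
def IsBracketOf (𝒢 : Set M) (X Y : ∀ q : Proj M, leftIdeal q) (q : Proj M)
    (z : leftIdeal q) : Prop :=
  ∀ γ δ, IsCurveIn (sourceFibre 𝒢 q) (unit q) (X q) γ →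
    IsCurveIn (sourceFibre 𝒢 q) (unit q) (Y q) δ →
    ∃ v w : leftIdeal q, HasDerivAt (fun t => rightInv q Y (γ t)) v 0 ∧
      HasDerivAt (fun t => rightInv q X (δ t)) w 0 ∧ z = v - w

end

end WStarGroupoid

open WStarGroupoid

namespace WStarGroupoid

/-! ### Supports and relative left inverses -/

section Supports

variable {M : Type*} [CStarAlgebra M]

/-! An element is partially invertible with right support `e` exactly when it lies in `Me` and has a
left inverse relative to `e` (`isPartiallyInvertible_and_rsupp_iff`). For such `x` the element `x*x
+ (1 - e)` is invertible (`LInv.isUnit`), so `g = (x*x + 1 - e)⁻¹ x*` satisfies `gx = e`, and `l(x)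
= xg`. Supports thus become rational expressions in `x` and `x*`. The source fibres of `G` are open
in `Me`, and `l` is smooth on them, since inversion in `M` is smooth; the real-linear adjoint is the
reason for working over `ℝ`. In the chart at `p` the left support of `η` has coordinate `ηk - p`,
with `k` a relative inverse of `pη`, and this gives the atlas, the transition maps and the tangent
map of `l`.

The fibres of `A` are therefore the whole spaces `Mq`. Right multiplication by `η` is a linear map
from `Mq` to `Me` that carries the unit to `η` and intertwines right-invariant fields, so these
fields are closed under the Lie bracket (`lieBracket_rightInv`). The Jacobi and Leibniz identities
for sections are those of vector fields on a source fibre. The anchor respects brackets because a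
right-invariant field is related through `l` to its anchor (`fderiv_chart_rightInv`).

The source fibres of `U` are cut out by `η*η = q`. Linearizing at the unit gives `qx + x*q = 0`, and
exponentials of skew-adjoint elements realize every solution, so this equation describes `Aᵘ`
(`mem_algU_iff`). Differentiating it along unitary curves shows that the bracket preserves it
(`bracket_mem_algU`). With `σ = p + y` it says that `σ*xσ` is skew-adjoint, which straightens the
subbundle (`IsChartSec.skew_iff`). The vectors `(1 - q)vq` satisfy it trivially and already exhaust
the tangent space of `L`. -/

lemma Proj.mul_self (p : Proj M) : (p : M) * p = p := p.2.isIdempotentElem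

lemma Proj.star_eq (p : Proj M) : star (p : M) = p := p.2.isSelfAdjoint

lemma IsLeftSupport.unique {x : M} {q q' : Proj M} (h : IsLeftSupport x q)
    (h' : IsLeftSupport x q') : q = q' := by
  have h1 := h.2 q' h'.1
  have h2 := congrArg star (h'.2 q h.1)
  rw [star_mul, q.star_eq, q'.star_eq, h1] at h2
  exact Subtype.ext h2

lemma IsRightSupport.unique {x : M} {q q' : Proj M} (h : IsRightSupport x q)
    (h' : IsRightSupport x q') : q = q' := by
  have h1 := h.2 q' h'.1
  have h2 := congrArg star (h'.2 q h.1)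
  rw [star_mul, q.star_eq, q'.star_eq, h1] at h2
  exact Subtype.ext h2

lemma IsLeftSupport.lsupp_eq {x : M} {q : Proj M} (h : IsLeftSupport x q) : lsupp x = q := by
  have hex : ∃ q, IsLeftSupport x q := ⟨q, h⟩
  rw [lsupp, dif_pos hex]
  exact hex.choose_spec.unique h

lemma IsRightSupport.rsupp_eq {x : M} {q : Proj M} (h : IsRightSupport x q) : rsupp x = q := by
  have hex : ∃ q, IsRightSupport x q := ⟨q, h⟩
  rw [rsupp, dif_pos hex]
  exact hex.choose_spec.unique h

/-- The elements `x` of `Me` that have a left inverse relative to `e`. -/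
def LInv (e : Proj M) : Set M := {x | x * e = x ∧ ∃ w, w * x = e}

/-- The relative left inverse `(x* x)⁻¹ x*` of an element of `LInv e`. -/
noncomputable def ginv (e : Proj M) (x : M) : M :=
  Ring.inverse (star x * x + (1 - e)) * star x

lemma self_mem_LInv (p : Proj M) : (p : M) ∈ LInv p := ⟨p.mul_self, 1, one_mul _⟩

lemma LInv.isRightSupport {e : Proj M} {x : M} (hx : x ∈ LInv e) : IsRightSupport x e := by
  obtain ⟨h, w, hw⟩ := hx
  refine ⟨h, fun q' hq' => ?_⟩
  rw [← hw, mul_assoc, hq']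

lemma LInv.rsupp_eq {e : Proj M} {x : M} (hx : x ∈ LInv e) : rsupp x = e :=
  (LInv.isRightSupport hx).rsupp_eq

lemma LInv.mul_mem {e q : Proj M} {x z : M} (hx : x ∈ LInv q) (hz : z ∈ LInv e)
    (hqz : (q : M) * z = z) : x * z ∈ LInv e := by
  obtain ⟨-, w, hw⟩ := hx
  obtain ⟨h, v, hv⟩ := hz
  refine ⟨by rw [mul_assoc, h], v * w, ?_⟩
  rw [mul_assoc, ← mul_assoc w, hw, hqz, hv]

section Order

variable [PartialOrder M] [StarOrderedRing M]

/-- From `wx = e` one gets `e = x*(w*w)x ≤ ‖w*w‖ x*x`. Adding `1 - e ≥ 0` bounds a positive multiple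
of the element below by `1`. -/
lemma LInv.isUnit {e : Proj M} {x : M} (hx : x ∈ LInv e) :
    IsUnit (star x * x + (1 - (e : M))) := by
  obtain ⟨h, w, hw⟩ := hx
  have h1 : (e : M) ≤ ‖star w * w‖ • (star x * x) := by
    have := CStarAlgebra.star_left_conjugate_le_norm_smul (a := x) (b := star w * w)
      (IsSelfAdjoint.star_mul_self w)
    refine le_trans (le_of_eq ?_) this
    rw [mul_assoc, mul_assoc, hw, ← mul_assoc, ← star_mul, hw, e.star_eq, e.mul_self]
  have h2 : (0 : M) ≤ 1 - (e : M) := by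
    have h3 : star (1 - (e : M)) * (1 - e) = 1 - e := by
      rw [star_sub, star_one, e.star_eq, sub_mul, mul_sub, mul_sub, e.mul_self]; simp
    rw [← h3]; exact star_mul_self_nonneg _
  set c : ℝ := ‖star w * w‖ + 1 with hc
  have hc1 : 1 ≤ c := by have := norm_nonneg (star w * w); linarith
  have h4 : (1 : M) ≤ c • (star x * x + (1 - (e : M))) := by
    have h5 : 0 ≤ star x * x := star_mul_self_nonneg _
    have h6 : (1 : M) - e ≤ c • (1 - (e : M)) := by
      have : (0 : M) ≤ (c - 1) • (1 - (e : M)) := smul_nonneg (by linarith) h2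
      rw [sub_smul, one_smul] at this
      exact sub_nonneg.1 this
    have h7 : (e : M) ≤ c • (star x * x) := by
      rw [hc, add_smul, one_smul]
      exact h1.trans (le_add_of_nonneg_right h5)
    rw [smul_add]
    calc (1 : M) = e + (1 - e) := by abel
      _ ≤ _ := add_le_add h7 h6
  have h8 := CStarAlgebra.isUnit_of_le 1 h4
  have hc0 : c ≠ 0 := by linarith
  rw [show c • (star x * x + (1 - (e : M))) = (Units.mk0 c hc0) • (star x * x + (1 - (e : M)))
    from rfl, isUnit_smul_iff] at h8
  exact h8

omit [PartialOrder M] [StarOrderedRing M] in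
lemma LInv.star_mul {e : Proj M} {x : M} (hx : x ∈ LInv e) : (e : M) * star x = star x := by
  have := congrArg star hx.1
  rwa [StarMul.star_mul, e.star_eq] at this

lemma LInv.inverse_mul {e : Proj M} {x : M} (hx : x ∈ LInv e) :
    Ring.inverse (star x * x + (1 - (e : M))) * (star x * x) = e := by
  have h : star x * x = (star x * x + (1 - (e : M))) * e := by
    rw [add_mul, sub_mul, one_mul, e.mul_self, sub_self, add_zero, mul_assoc, hx.1]
  conv_lhs => arg 2; rw [h]
  rw [Ring.inverse_mul_cancel_left _ _ (LInv.isUnit hx)]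

lemma LInv.mul_inverse {e : Proj M} {x : M} (hx : x ∈ LInv e) :
    (star x * x) * Ring.inverse (star x * x + (1 - (e : M))) = e := by
  have h : star x * x = e * (star x * x + (1 - (e : M))) := by
    rw [mul_add, mul_sub, mul_one, e.mul_self, sub_self, add_zero, ← mul_assoc, LInv.star_mul hx]
  conv_lhs => arg 1; rw [h]
  rw [Ring.mul_inverse_cancel_right _ _ (LInv.isUnit hx)]

/-- With `r` the inverse, both sides equal `r (x*x) r`. -/
lemma LInv.inverse_comm {e : Proj M} {x : M} (hx : x ∈ LInv e) :
    (e : M) * Ring.inverse (star x * x + (1 - (e : M))) =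
      Ring.inverse (star x * x + (1 - (e : M))) * e := by
  nth_rewrite 1 [← LInv.inverse_mul hx]
  nth_rewrite 4 [← LInv.mul_inverse hx]
  simp only [mul_assoc]

lemma LInv.ginv_mul {e : Proj M} {x : M} (hx : x ∈ LInv e) : ginv e x * x = e := by
  rw [ginv, mul_assoc, LInv.inverse_mul hx]

lemma LInv.mul_ginv {e : Proj M} {x : M} (hx : x ∈ LInv e) : (e : M) * ginv e x = ginv e x := by
  rw [ginv, ← mul_assoc, LInv.inverse_comm hx, mul_assoc, LInv.star_mul hx]

/-- The product `x g` with `g = ginv e x` is self-adjoint by its formula, and idempotent since `gx =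
e` and `eg = g`. Any projection fixing `x` on the left fixes `xg` too. -/
lemma LInv.isLeftSupport {e : Proj M} {x : M} (hx : x ∈ LInv e) :
    ∃ q : Proj M, IsLeftSupport x q ∧ (q : M) = x * ginv e x := by
  have hsa : star (Ring.inverse (star x * x + (1 - (e : M)))) =
      Ring.inverse (star x * x + (1 - (e : M))) := by
    rw [← Ring.inverse_star]
    simp [e.star_eq]
  have hst : star (x * ginv e x) = x * ginv e x := by
    rw [ginv, StarMul.star_mul, StarMul.star_mul, star_star, hsa, mul_assoc]
  have hid : x * ginv e x * (x * ginv e x) = x * ginv e x := by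
    rw [mul_assoc, ← mul_assoc (ginv e x), LInv.ginv_mul hx, LInv.mul_ginv hx]
  refine ⟨⟨x * ginv e x, hid, hst⟩, ⟨?_, fun q' hq' => ?_⟩, rfl⟩
  · change x * ginv e x * x = x
    rw [mul_assoc, LInv.ginv_mul hx, hx.1]
  · change x * ginv e x * q' = x * ginv e x
    have : (q' : M) * (x * ginv e x) = x * ginv e x := by rw [← mul_assoc, hq']
    have h2 := congrArg star this
    rwa [StarMul.star_mul, hst, q'.star_eq] at h2

lemma LInv.isLeftSupport_lsupp {e : Proj M} {x : M} (hx : x ∈ LInv e) :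
    IsLeftSupport x (lsupp x) := by
  obtain ⟨q, hq, -⟩ := LInv.isLeftSupport hx
  rwa [hq.lsupp_eq]

lemma LInv.coe_lsupp {e : Proj M} {x : M} (hx : x ∈ LInv e) :
    (lsupp x : M) = x * ginv e x := by
  obtain ⟨q, hq, h⟩ := LInv.isLeftSupport hx
  rw [hq.lsupp_eq, h]

lemma LInv.lsupp_mul {e : Proj M} {x : M} (hx : x ∈ LInv e) : (lsupp x : M) * x = x :=
  (LInv.isLeftSupport_lsupp hx).1

omit [PartialOrder M] [StarOrderedRing M] in
lemma lsupp_proj (p : Proj M) : lsupp (p : M) = p :=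
  IsLeftSupport.lsupp_eq ⟨p.mul_self, fun q' h => by
    have := congrArg star h
    rwa [star_mul, p.star_eq, q'.star_eq] at this⟩

/-- Multiplying by `ginv e z` on the right cancels `z`, because `z * ginv e z = l(z)` and `x l(z) =
x`. Hence a projection fixing `xz` fixes `x`. -/
lemma LInv.lsupp_mul_eq {e : Proj M} {x z : M} (hz : z ∈ LInv e)
    (hx : x ∈ LInv (lsupp z)) : lsupp (x * z) = lsupp x := by
  have h := LInv.isLeftSupport_lsupp hx
  refine IsLeftSupport.lsupp_eq ⟨by rw [← mul_assoc, h.1], fun q' hq' => h.2 q' ?_⟩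
  have h2 := congrArg (· * ginv e z) hq'
  simp only [mul_assoc] at h2
  rwa [← LInv.coe_lsupp hz, hx.1] at h2

/-- By the C*-identity both vanishings are decided by `z* x*x z`. Hence `|x|` and `x` have the same
right support. -/
lemma abs_mul_eq_zero_iff (x z : M) : CFC.abs x * z = 0 ↔ x * z = 0 := by
  rw [← CStarRing.star_mul_self_eq_zero_iff, ← CStarRing.star_mul_self_eq_zero_iff (x * z)]
  rw [star_mul, star_mul, (CFC.abs_nonneg x).isSelfAdjoint.star_eq, mul_assoc, mul_assoc,
    ← mul_assoc (CFC.abs x), ← mul_assoc (star x), CFC.abs_mul_abs]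

lemma abs_mul_eq_iff (x z : M) : CFC.abs x * z = CFC.abs x ↔ x * z = x := by
  have := abs_mul_eq_zero_iff x (z - 1)
  simpa only [mul_sub, mul_one, sub_eq_zero] using this

lemma isRightSupport_abs_iff (x : M) (q : Proj M) :
    IsRightSupport (CFC.abs x) q ↔ IsRightSupport x q := by
  simp only [IsRightSupport, abs_mul_eq_iff]

/-- This removes `|x|` from the rest of the proof. If `k` inverts `|x|` in the corner, then `k k x*`
is a left inverse of `x`. Conversely, with `r = (x*x + 1 - e)⁻¹`, the elements `e r |x|` and `|x| r
e` are a left and a right inverse of `|x|` in `eMe`, hence equal. -/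
lemma isPartiallyInvertible_and_rsupp_iff (x : M) (e : Proj M) :
    IsPartiallyInvertible x ∧ rsupp x = e ↔ x ∈ LInv e := by
  constructor
  · rintro ⟨⟨p, hp, k, hk, -, h2⟩, rfl⟩
    have hr := (isRightSupport_abs_iff x p).1 hp
    rw [hr.rsupp_eq]
    refine ⟨hr.1, k * k * star x, ?_⟩
    rw [mul_assoc, ← CFC.abs_mul_abs, mul_assoc, ← mul_assoc k (CFC.abs x), h2, ← mul_assoc,
      show k * (p : M) = k from hk.2, h2]
  · intro hx
    refine ⟨⟨e, (isRightSupport_abs_iff x e).2 (LInv.isRightSupport hx), ?_⟩, LInv.rsupp_eq hx⟩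
    have ha1 : CFC.abs x * e = CFC.abs x := (abs_mul_eq_iff _ _).2 hx.1
    have ha2 : e * CFC.abs x = CFC.abs x := by
      have := congrArg star ha1
      rwa [star_mul, e.star_eq, (CFC.abs_nonneg x).isSelfAdjoint.star_eq] at this
    set r := Ring.inverse (star x * x + (1 - (e : M))) with hr
    have h1 : (e : M) * r * CFC.abs x * CFC.abs x = e := by
      rw [mul_assoc, CFC.abs_mul_abs, mul_assoc, LInv.inverse_mul hx, e.mul_self]
    have h2 : CFC.abs x * (CFC.abs x * r * e) = e := by
      rw [← mul_assoc, ← mul_assoc, CFC.abs_mul_abs, LInv.mul_inverse hx, e.mul_self]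
    have h3 : (e : M) * r * CFC.abs x = CFC.abs x * r * e := by
      calc (e : M) * r * CFC.abs x = e * r * CFC.abs x * e := by rw [mul_assoc _ _ (e : M), ha1]
        _ = e * r * CFC.abs x * (CFC.abs x * (CFC.abs x * r * e)) := by rw [h2]
        _ = e * (CFC.abs x * r * e) := by rw [← mul_assoc, h1]
        _ = _ := by rw [← mul_assoc, ← mul_assoc, ha2]
    refine ⟨(e : M) * r * CFC.abs x, ⟨?_, ?_⟩, ?_, h1⟩
    · change (e : M) * _ = _
      rw [← mul_assoc, ← mul_assoc, e.mul_self]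
    · change _ * (e : M) = _
      rw [mul_assoc, ha1]
    · rw [h3, h2]

lemma mem_orbit_iff {p₀ q : Proj M} : q ∈ orbit p₀ ↔ ∃ x ∈ LInv p₀, lsupp x = q := by
  simp only [orbit, Set.mem_ofPred_eq, ← isPartiallyInvertible_and_rsupp_iff, and_assoc]

lemma self_mem_orbit (p₀ : Proj M) : p₀ ∈ orbit p₀ :=
  mem_orbit_iff.2 ⟨p₀, self_mem_LInv p₀, lsupp_proj p₀⟩

lemma LInv.lsupp_mem_orbit {p₀ e : Proj M} (he : e ∈ orbit p₀) {x : M} (hx : x ∈ LInv e) :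
    lsupp x ∈ orbit p₀ := by
  obtain ⟨z, hz, rfl⟩ := mem_orbit_iff.1 he
  exact mem_orbit_iff.2 ⟨x * z, LInv.mul_mem hx hz (LInv.lsupp_mul hz), LInv.lsupp_mul_eq hz hx⟩

lemma mem_sourceFibre_groupoidG_iff {p₀ e : Proj M} (he : e ∈ orbit p₀) {η : leftIdeal e} :
    η ∈ sourceFibre (groupoidG p₀) e ↔ (η : M) ∈ LInv e := by
  rw [← isPartiallyInvertible_and_rsupp_iff]
  constructor
  · rintro ⟨⟨h, -, -⟩, h'⟩
    exact ⟨h, h'⟩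
  · intro h
    refine ⟨⟨h.1, LInv.lsupp_mem_orbit he ((isPartiallyInvertible_and_rsupp_iff _ _).1 h), ?_⟩, h.2⟩
    rwa [h.2]

omit [PartialOrder M] [StarOrderedRing M] in
lemma mem_LInv_of_star_mul_self {e : Proj M} {x : M} (h : x * e = x) (h' : star x * x = e) :
    x ∈ LInv e := ⟨h, _, h'⟩

/-- Multiplying `x x* x = x` on the left by the relative left inverse leaves `x*x = e`. -/
lemma mem_sourceFibre_groupoidU_iff {p₀ e : Proj M} (he : e ∈ orbit p₀) {η : leftIdeal e} :
    η ∈ sourceFibre (groupoidU p₀) e ↔ star (η : M) * η = e := by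
  constructor
  · rintro ⟨⟨h, h2⟩, h'⟩
    have hL : (η : M) ∈ LInv e := (mem_sourceFibre_groupoidG_iff he).1 ⟨h, h'⟩
    have h3 := congrArg (ginv e (η : M) * ·) h2
    rwa [LInv.ginv_mul hL, ← mul_assoc, ← mul_assoc, LInv.ginv_mul hL, LInv.star_mul hL] at h3
  · intro h
    have hL := mem_LInv_of_star_mul_self η.2 h
    have := (mem_sourceFibre_groupoidG_iff he).2 hL
    exact ⟨⟨this.1, by rw [mul_assoc, h]; exact η.2⟩, this.2⟩

lemma lsupp_eq_mul_star {e : Proj M} {x : M} (h : x * e = x) (h' : star x * x = e) :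
    (lsupp x : M) = x * star x := by
  have hL := mem_LInv_of_star_mul_self h h'
  rw [LInv.coe_lsupp hL, ginv, h']
  simp

/-! ### Charts, algebraically -/

/-- `σ = p + y` where `y` is the coordinate of `Q` in the chart at `p`. -/
structure IsChartSec (p Q : Proj M) (σ : M) : Prop where
  left_mul : (Q : M) * σ = σ
  mul_right : σ * p = σ
  base_mul : (p : M) * σ = p
  mul_mul : σ * p * Q = Q

namespace IsChartSec

variable {p Q : Proj M} {σ : M}

omit [PartialOrder M] [StarOrderedRing M] in
lemma mul_proj (h : IsChartSec p Q σ) : σ * Q = Q := by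
  have := h.mul_mul
  rwa [h.mul_right] at this

omit [PartialOrder M] [StarOrderedRing M] in
lemma mul_self (h : IsChartSec p Q σ) : σ * σ = σ := by
  nth_rewrite 1 [← h.mul_right]
  rw [mul_assoc, h.base_mul, h.mul_right]

omit [PartialOrder M] [StarOrderedRing M] in
lemma mem_LInv (h : IsChartSec p Q σ) : σ ∈ LInv p := ⟨h.mul_right, p, h.base_mul⟩

omit [PartialOrder M] [StarOrderedRing M] in
lemma lsupp_eq (h : IsChartSec p Q σ) : lsupp σ = Q :=
  IsLeftSupport.lsupp_eq ⟨h.left_mul, fun q' hq' => by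
    have h1 : (q' : M) * Q = Q := by rw [← h.mul_mul, ← mul_assoc, ← mul_assoc, hq']
    have := congrArg star h1
    rwa [star_mul, Q.star_eq, q'.star_eq] at this⟩

omit [PartialOrder M] [StarOrderedRing M] in
-- The idempotent `σ` projects onto `QM` along `(1-p)M`, so `z = σpz + (z - σpz)` is the required
-- decomposition.
lemma mem_chartDom (h : IsChartSec p Q σ) : Q ∈ chartDom p := by
  refine IsCompl.of_eq ?_ ?_
  · rw [Submodule.eq_bot_iff]
    rintro z ⟨hz1, hz2⟩
    have hz1 : (Q : M) * z = z := hz1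
    have hz2 : (1 - (p : M)) * z = z := hz2
    have hz3 : (p : M) * z = 0 := by simpa [sub_mul] using hz2
    rw [← hz1, ← h.mul_mul, mul_assoc, hz1, mul_assoc, hz3, mul_zero]
  · rw [Submodule.eq_top_iff']
    intro z
    refine Submodule.mem_sup.2 ⟨σ * (p * z), ?_, z - σ * (p * z), ?_, by abel⟩
    · change (Q : M) * _ = _
      rw [← mul_assoc, h.left_mul]
    · change (1 - (p : M)) * _ = _
      rw [sub_mul, one_mul, mul_sub, ← mul_assoc (p : M) σ, h.base_mul, ← mul_assoc (p : M) (p : M),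
        p.mul_self, sub_self, sub_zero]

omit [PartialOrder M] [StarOrderedRing M] in
/-- The coordinate of `Q` in the chart at `p`. -/
lemma sub_mem (h : IsChartSec p Q σ) : σ - p ∈ chartSpace p := by
  refine ⟨?_, ?_⟩
  · change (1 - (p : M)) * _ = _
    rw [sub_mul, one_mul, mul_sub, h.base_mul, p.mul_self, sub_self, sub_zero]
  · change _ * (p : M) = _
    rw [sub_mul, h.mul_right, p.mul_self]

omit [PartialOrder M] [StarOrderedRing M] in
-- The choice made in `chart` is forced: two candidates differ by an element of `QM ∩ (1-p)M = 0`.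
lemma chart_eq (h : IsChartSec p Q σ) : (p : M) + chart p Q = σ := by
  have hex : Q ∈ chartDom p ∧ ∃ y : chartSpace p, (p : M) + y ∈ rightIdeal (Q : M) :=
    ⟨h.mem_chartDom, ⟨σ - p, h.sub_mem⟩, by
      change (Q : M) * (p + (σ - p)) = p + (σ - p)
      rw [add_sub_cancel, h.left_mul]⟩
  have h1 : (p : M) + chart p Q ∈ rightIdeal (Q : M) := by
    rw [chart, dif_pos hex]; exact hex.2.choose_spec
  have h2 : (p : M) + chart p Q - σ ∈ rightIdeal (Q : M) :=
    Submodule.sub_mem _ h1 h.left_mul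
  have h3 : (p : M) + chart p Q - σ ∈ rightIdeal (1 - (p : M)) := by
    rw [show (p : M) + chart p Q - σ = chart p Q - (σ - p) by abel]
    exact Submodule.sub_mem _ (chart p Q).2.1 h.sub_mem.1
  exact sub_eq_zero.1 (Submodule.disjoint_def.1 h.mem_chartDom.disjoint _ h2 h3)

omit [PartialOrder M] [StarOrderedRing M] in
lemma chartInv_chart (h : IsChartSec p Q σ) : chartInv p (chart p Q) = Q := by
  rw [chartInv, h.chart_eq, h.lsupp_eq]

end IsChartSec

lemma isChartSec_chartInv (p : Proj M) (y : chartSpace p) :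
    IsChartSec p (chartInv p y) ((p : M) + y) := by
  have hL : (p : M) + y ∈ LInv p := ⟨sigma_mul p y, p, mul_sigma p y⟩
  refine ⟨LInv.lsupp_mul hL, sigma_mul p y, mul_sigma p y, ?_⟩
  rw [chartInv, LInv.coe_lsupp hL, sigma_mul, ← mul_assoc]
  congr 1
  nth_rewrite 1 [← sigma_mul]
  rw [mul_assoc, mul_sigma, sigma_mul]

lemma sigma_mem_LInv (p : Proj M) (y : chartSpace p) : (p : M) + y ∈ LInv p :=
  (isChartSec_chartInv p y).mem_LInv

lemma chart_chartInv (p : Proj M) (y : chartSpace p) : chart p (chartInv p y) = y := by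
  have := (isChartSec_chartInv p y).chart_eq
  exact Subtype.ext (add_left_cancel this)

omit [PartialOrder M] [StarOrderedRing M] in
-- The component `s` of `p` in `QM` is the candidate. Both `sp - s` and `spQ - Q` lie in `QM` and in
-- `(1-p)M`, so they vanish.
lemma isChartSec_of_mem_chartDom {p Q : Proj M} (h : Q ∈ chartDom p) :
    IsChartSec p Q ((p : M) + chart p Q) := by
  have hdis := Submodule.disjoint_def.1 h.disjoint
  obtain ⟨s, hs, t, ht, hst⟩ := Submodule.mem_sup.1
    ((Submodule.eq_top_iff'.1 h.sup_eq_top) (p : M))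
  have hs : (Q : M) * s = s := hs
  have ht : (1 - (p : M)) * t = t := ht
  have ht0 : (p : M) * t = 0 := by simpa [sub_mul] using ht
  have hps : (p : M) * s = p := by
    have := congrArg ((p : M) * ·) hst
    simpa [mul_add, ht0, p.mul_self] using this
  have hsp : s * p = s := by
    refine sub_eq_zero.1 (hdis _ ?_ ?_)
    · change (Q : M) * (s * p - s) = _
      rw [mul_sub, ← mul_assoc, hs]
    · change (1 - (p : M)) * (s * p - s) = _
      rw [sub_mul, one_mul, mul_sub, ← mul_assoc, hps, p.mul_self, sub_self, sub_zero]
  have hsec : IsChartSec p Q s := by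
    refine ⟨hs, hsp, hps, ?_⟩
    refine sub_eq_zero.1 (hdis _ ?_ ?_)
    · change (Q : M) * (s * p * Q - Q) = _
      rw [mul_sub, Q.mul_self, ← mul_assoc, ← mul_assoc, hs]
    · change (1 - (p : M)) * (s * p * Q - Q) = _
      rw [sub_mul, one_mul, mul_sub, ← mul_assoc, ← mul_assoc, hps, p.mul_self, sub_self, sub_zero]
  rwa [hsec.chart_eq]

omit [PartialOrder M] [StarOrderedRing M] in
lemma mem_chartDom_self (p : Proj M) : p ∈ chartDom p :=
  IsChartSec.mem_chartDom (σ := p) ⟨p.mul_self, p.mul_self, p.mul_self, by simp [p.mul_self]⟩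

lemma chartInv_mem_orbit {p₀ p : Proj M} (hp : p ∈ orbit p₀) (y : chartSpace p) :
    chartInv p y ∈ orbit p₀ := LInv.lsupp_mem_orbit hp (sigma_mem_LInv p y)

lemma chartDom_subset_orbit {p₀ p : Proj M} (hp : p ∈ orbit p₀) : chartDom p ⊆ orbit p₀ := by
  intro q hq
  rw [← (isChartSec_of_mem_chartDom hq).chartInv_chart]
  exact chartInv_mem_orbit hp _

/-- The relative inverse `k` of `pη`, for `l(η)` in the domain of the chart at `p`. -/
structure IsRelInv (p e : Proj M) (η k : M) : Prop where
  mul_right : k * p = k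
  left_mul : (e : M) * k = k
  mul_eq : p * η * k = p
  eq_mul : k * p * η = e

/-- This turns the chart at `l(η)` into the product `ηk`, free of supports and choices. -/
lemma IsRelInv.isChartSec {p e : Proj M} {η k : M} (hη : η ∈ LInv e) (h : IsRelInv p e η k) :
    IsChartSec p (lsupp η) (η * k) := by
  refine ⟨by rw [← mul_assoc, LInv.lsupp_mul hη], by rw [mul_assoc, h.mul_right],
    by rw [← mul_assoc, h.mul_eq], ?_⟩
  rw [LInv.coe_lsupp hη, ← mul_assoc, mul_assoc η, mul_assoc η, h.eq_mul, hη.1]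

lemma IsChartSec.isRelInv {p e : Proj M} {η σ : M} (hη : η ∈ LInv e)
    (h : IsChartSec p (lsupp η) σ) :
    IsRelInv p e η (ginv e η * σ) ∧ η * (ginv e η * σ) = σ := by
  have h1 : η * (ginv e η * σ) = σ := by rw [← mul_assoc, ← LInv.coe_lsupp hη, h.left_mul]
  refine ⟨⟨by rw [mul_assoc, h.mul_right], by rw [← mul_assoc, LInv.mul_ginv hη],
    by rw [mul_assoc, h1, h.base_mul], ?_⟩, h1⟩
  rw [mul_assoc (ginv e η), mul_assoc (ginv e η), ← LInv.lsupp_mul hη, ← mul_assoc (σ * p),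
    h.mul_mul, LInv.lsupp_mul hη, LInv.ginv_mul hη]

lemma exists_isRelInv {p e : Proj M} {η : M} (hη : η ∈ LInv e) (h : lsupp η ∈ chartDom p) :
    ∃ k, IsRelInv p e η k ∧ η * k = p + chart p (lsupp η) :=
  ⟨_, (isChartSec_of_mem_chartDom h).isRelInv hη⟩

omit [PartialOrder M] [StarOrderedRing M] in
-- Invertibility of `u` supplies a right inverse of `pη` and invertibility of `v` a left inverse;
-- the two agree, so the formula may use `u` alone. At `η = η₀` both `u` and `v` equal `1`, so the
-- hypotheses persist nearby.
lemma IsRelInv.perturb {p e : Proj M} {η₀ k₀ η : M} (h : IsRelInv p e η₀ k₀) (hη : η * e = η)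
    (hu : IsUnit (p * η * k₀ + (1 - (p : M)))) (hv : IsUnit (k₀ * p * η + (1 - (e : M)))) :
    IsRelInv p e η (k₀ * Ring.inverse (p * η * k₀ + (1 - (p : M))) * p) := by
  set u := p * η * k₀ + (1 - (p : M)) with hudef
  set v := k₀ * p * η + (1 - (e : M)) with hvdef
  have hpu : (p : M) * u = p * η * k₀ := by
    rw [hudef, mul_add, mul_sub, mul_one, ← mul_assoc, ← mul_assoc, p.mul_self, sub_self, add_zero]
  have hve : v * e = k₀ * p * η := by
    rw [hvdef, add_mul, sub_mul, one_mul, mul_assoc, hη, e.mul_self, sub_self, add_zero]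
  have hev : e * v = k₀ * p * η := by
    rw [hvdef, mul_add, mul_sub, mul_one, ← mul_assoc, ← mul_assoc, h.left_mul, e.mul_self,
      sub_self, add_zero]
  have h1 : p * η * (k₀ * Ring.inverse u * p) = p := by
    rw [← mul_assoc, ← mul_assoc, ← hpu, mul_assoc _ u, Ring.mul_inverse_cancel _ hu, mul_one,
      p.mul_self]
  have h2 : Ring.inverse v * k₀ * (p * η) = e := by
    rw [mul_assoc, ← mul_assoc k₀, ← hve, Ring.inverse_mul_cancel_left _ _ hv]
  set k := k₀ * Ring.inverse u * p with hk
  have hek : (e : M) * k = k := by rw [hk, ← mul_assoc, ← mul_assoc, h.left_mul]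
  have hkp : k * p = k := by rw [hk, mul_assoc, p.mul_self]
  refine ⟨hkp, hek, h1, ?_⟩
  calc k * p * η = (e * k) * p * η := by rw [hek]
    _ = Ring.inverse v * k₀ * (p * η * k) * p * η := by rw [← h2]; simp only [mul_assoc]
    _ = Ring.inverse v * k₀ * ((p * p) * η) := by rw [h1]; simp only [mul_assoc]
    _ = e := by rw [p.mul_self, h2]

/-! ### Bundle charts, algebraically -/

omit [PartialOrder M] [StarOrderedRing M] in
lemma coordA_mul_sigma {p : Proj M} {y : chartSpace p} {x : M} :
    x * (p + y) = coordA p y x + (p + y) * coordB p y x := by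
  have h := sigma_mul p y
  simp only [coordA, coordB]
  rw [← mul_assoc, ← mul_assoc, h, sub_mul, sub_mul, one_mul, sub_add_cancel]

/-- With `σ = p + y` and `q = l(σ)`, multiply `xσ = a + σb` on the right by `q` and use `σq = q`,
`xq = x`. -/
lemma eq_of_bundleCoord {p : Proj M} {y : chartSpace p} {x : M}
    (hx : x * (chartInv p y : M) = x) :
    x = (coordA p y x + (p + y) * coordB p y x) * (chartInv p y : M) := by
  rw [← coordA_mul_sigma, mul_assoc, (isChartSec_chartInv p y).mul_proj, hx]

lemma bundleCoord_mul_chartInv {p : Proj M} {y : chartSpace p} (a : chartSpace p) (b : corner p) :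
    bundleCoord p y ((a + (p + y) * b) * (chartInv p y : M)) = (a, b) := by
  have h := isChartSec_chartInv p y
  have ha : (a : M) * (p + y) = a := by
    rw [← chart_mul p a, mul_assoc, mul_sigma]
  have hb1 : (b : M) * p = b := b.2.2
  have hb2 : (p : M) * b = b := b.2.1
  have hb : (b : M) * (p + y) = b := by
    rw [← hb1, mul_assoc, mul_sigma]
  have hya : ((p : M) + y) * a = 0 := by
    rw [← sigma_mul, mul_assoc, mul_chart, mul_zero]
  have key : ((a : M) + (p + y) * b) * (chartInv p y : M) * (p + y) = a + (p + y) * b := by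
    rw [mul_assoc, h.left_mul, add_mul, ha, mul_assoc, hb]
  refine Prod.ext (Subtype.ext ?_) (Subtype.ext ?_)
  · change (1 - ((p : M) + y)) * _ * (p + y) = a
    rw [mul_assoc, key, sub_mul, one_mul, mul_add, hya, ← mul_assoc, h.mul_self, zero_add,
      add_sub_cancel_right]
  · change (p : M) * _ * (p + y) = b
    rw [mul_assoc, key, mul_add, mul_chart, ← mul_assoc, mul_sigma, hb2, zero_add]

end Order

end Supports

end WStarGroupoid

namespace WStarGroupoid

/-! ### Smoothness of the left support and of the charts -/

section Smooth

variable {M : Type*} [CStarAlgebra M]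

/-- Right multiplication by `e`, as a projection of `M` onto `Me`. -/
noncomputable def projL (e : Proj M) : M →L[ℝ] leftIdeal e :=
  ((ContinuousLinearMap.mul ℝ M).flip (e : M)).codRestrict _ fun x => by
    change x * (e : M) * e = x * e
    rw [mul_assoc, e.mul_self]

/-- The projection `x ↦ (1-p)xp` of `M` onto `(1-p)Mp`. -/
noncomputable def projA (p : Proj M) : M →L[ℝ] chartSpace p :=
  (ContinuousLinearMap.mulLeftRight ℝ M (1 - p : M) p).codRestrict _ fun x => by
    have h : (1 - (p : M)) * (1 - p) = 1 - p := p.2.one_sub.isIdempotentElem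
    refine ⟨?_, ?_⟩
    · change (1 - (p : M)) * ((1 - p) * x * p) = (1 - p) * x * p
      rw [← mul_assoc, ← mul_assoc, h]
    · change ((1 - (p : M)) * x * p) * p = (1 - p) * x * p
      rw [mul_assoc, p.mul_self]

/-- The projection `x ↦ pxp` of `M` onto `pMp`. -/
noncomputable def projB (p : Proj M) : M →L[ℝ] corner p :=
  (ContinuousLinearMap.mulLeftRight ℝ M (p : M) p).codRestrict _ fun x => by
    refine ⟨?_, ?_⟩
    · change (p : M) * (p * x * p) = p * x * p
      rw [← mul_assoc, ← mul_assoc, p.mul_self]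
    · change (p * x * p) * p = p * x * p
      rw [mul_assoc, p.mul_self]

lemma coe_projL (e : Proj M) (x : M) : (projL e x : M) = x * e := rfl

lemma coe_projA (p : Proj M) (x : M) : (projA p x : M) = (1 - p) * x * p := rfl

lemma coe_projB (p : Proj M) (x : M) : (projB p x : M) = p * x * p := rfl

lemma projL_coe {e : Proj M} (x : leftIdeal e) : projL e x = x := Subtype.ext x.2

lemma rightTranslate_eq {e q : Proj M} (η : leftIdeal e) (x : leftIdeal q) :
    rightTranslate η x = projL e (x * η) :=
  (projL_coe (rightTranslate η x)).symm

lemma coordA_eq (p : Proj M) (y : chartSpace p) (x : M) :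
    coordA p y x = projA p ((1 - (p + y)) * x * (p + y)) := by
  refine Subtype.ext ?_
  rw [coe_projA]
  have h1 := (coordA p y x).2.1
  have h2 := (coordA p y x).2.2
  change (1 - (p : M)) * (coordA p y x) = _ at h1
  change (coordA p y x : M) * p = _ at h2
  change _ = (1 - (p : M)) * (coordA p y x) * p
  rw [h1, h2]

lemma coordB_eq (p : Proj M) (y : chartSpace p) (x : M) :
    coordB p y x = projB p (x * (p + y)) := by
  refine Subtype.ext ?_
  rw [coe_projB, mul_assoc, mul_assoc, sigma_mul, ← mul_assoc]
  rfl

lemma contDiff_star {n : ℕ∞ω} : ContDiff ℝ n (star : M → M) :=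
  (starL' ℝ : M ≃L[ℝ] M).contDiff

section Calculus

variable {E : Type*} [NormedAddCommGroup E]

lemma contDiffAt_inverse [NormedSpace ℝ E] {f : E → M} {x : E} {n : ℕ∞ω} (hf : ContDiffAt ℝ n f x)
    (h : IsUnit (f x)) : ContDiffAt ℝ n (fun z => Ring.inverse (f z)) x := by
  obtain ⟨u, hu⟩ := h
  have := contDiffAt_ringInverse ℝ (n := n) u
  rw [hu] at this
  exact this.comp x hf

lemma eventually_isUnit {f : E → M} {x : E} (hf : ContinuousAt f x) (h : IsUnit (f x)) :
    ∀ᶠ z in 𝓝 x, IsUnit (f z) :=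
  hf.eventually (Units.isOpen.mem_nhds h)

lemma contDiff_coe_submodule (S : Submodule ℝ M) {n : ℕ∞ω} : ContDiff ℝ n ((↑) : S → M) :=
  S.subtypeL.contDiff

lemma continuous_coe_submodule (S : Submodule ℝ M) : Continuous ((↑) : S → M) :=
  S.subtypeL.continuous

end Calculus

/-- If `wη₀ = e`, then `ewη + (1 - e)` is `1` at `η₀` and stays invertible nearby; its inverse times
`ew` is a left inverse of `η`. -/
lemma isOpen_LInv (e : Proj M) : IsOpen {η : leftIdeal e | (η : M) ∈ LInv e} := by
  rw [isOpen_iff_mem_nhds]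
  rintro η₀ ⟨-, w, hw⟩
  have hc : Continuous fun η : leftIdeal e => (e : M) * w * η + (1 - e) := by
    have := continuous_coe_submodule (leftIdeal e)
    fun_prop
  have hu : IsUnit ((e : M) * w * η₀ + (1 - e)) := by
    rw [mul_assoc, hw, e.mul_self]; simp
  filter_upwards [eventually_isUnit hc.continuousAt hu] with η hη
  have hηe : (η : M) * e = η := η.2
  refine ⟨hηe, Ring.inverse ((e : M) * w * η + (1 - e)) * (e * w), ?_⟩
  have h : (e : M) * w * η = (e * w * η + (1 - e)) * e := by
    rw [add_mul, sub_mul, one_mul, e.mul_self, sub_self, add_zero, mul_assoc _ (η : M) (e : M), hηe]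
  rw [mul_assoc]
  conv_lhs => arg 2; rw [h]
  rw [Ring.inverse_mul_cancel_left _ _ hη]

lemma eventually_LInv {e : Proj M} {η : leftIdeal e} (h : (η : M) ∈ LInv e) :
    ∀ᶠ ζ : leftIdeal e in 𝓝 η, (ζ : M) ∈ LInv e :=
  (isOpen_LInv e).mem_nhds h

section Order

variable [PartialOrder M] [StarOrderedRing M]

lemma contDiffAt_ginv {e : Proj M} {η : leftIdeal e} (h : (η : M) ∈ LInv e) :
    ContDiffAt ℝ ∞ (fun ζ : leftIdeal e => ginv e (ζ : M)) η := by
  have h1 := (contDiff_coe_submodule (leftIdeal e) (n := ∞)).contDiffAt (x := η)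
  have h2 : ContDiffAt ℝ ∞ (fun ζ : leftIdeal e => star (ζ : M)) η :=
    contDiff_star.contDiffAt.comp η h1
  exact (contDiffAt_inverse ((h2.mul h1).add contDiffAt_const) (LInv.isUnit h)).mul h2

lemma contDiffAt_coe_lsupp {e : Proj M} {η : leftIdeal e} (h : (η : M) ∈ LInv e) :
    ContDiffAt ℝ ∞ (fun ζ : leftIdeal e => (lsupp (ζ : M) : M)) η := by
  refine (((contDiff_coe_submodule _).contDiffAt.mul (contDiffAt_ginv h))).congr_of_eventuallyEq ?_
  filter_upwards [eventually_LInv h] with ζ hζ using LInv.coe_lsupp hζ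

omit [PartialOrder M] [StarOrderedRing M] in
lemma eventually_isRelInv {p e : Proj M} {η₀ : leftIdeal e} {k₀ : M}
    (h : IsRelInv p e (η₀ : M) k₀) : ∀ᶠ η : leftIdeal e in 𝓝 η₀,
      IsRelInv p e (η : M) (k₀ * Ring.inverse ((p : M) * η * k₀ + (1 - (p : M))) * p) := by
  have hc := continuous_coe_submodule (leftIdeal e)
  have h1 : Continuous fun η : leftIdeal e => (p : M) * η * k₀ + (1 - (p : M)) := by fun_prop
  have h2 : Continuous fun η : leftIdeal e => k₀ * p * η + (1 - (e : M)) := by fun_prop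
  filter_upwards [eventually_isUnit h1.continuousAt (by rw [h.mul_eq]; simp),
    eventually_isUnit h2.continuousAt (by rw [h.eq_mul]; simp)] with η hu hv
  exact h.perturb η.2 hu hv

lemma eventually_chart {p e : Proj M} {η₀ : leftIdeal e} {k₀ : M} (hη₀ : (η₀ : M) ∈ LInv e)
    (h : IsRelInv p e (η₀ : M) k₀) : ∀ᶠ η : leftIdeal e in 𝓝 η₀,
      lsupp (η : M) ∈ chartDom p ∧ chart p (lsupp (η : M)) =
        projA p (η * k₀ * Ring.inverse ((p : M) * η * k₀ + (1 - (p : M)))) := by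
  filter_upwards [eventually_isRelInv h, eventually_LInv hη₀] with η hk hη
  have hs := hk.isChartSec hη
  refine ⟨hs.mem_chartDom, Subtype.ext ?_⟩
  have h1 := hs.chart_eq
  have h2 : (1 - (p : M)) * (p + chart p (lsupp (η : M))) = chart p (lsupp (η : M)) := by
    rw [mul_add, sub_mul, one_mul, p.mul_self, sub_self, zero_add]
    exact (chart p (lsupp (η : M))).2.1
  rw [coe_projA, ← h2, h1]
  simp only [mul_assoc]

lemma eventually_lsupp_mem_chartDom {p e : Proj M} {η : leftIdeal e} (hη : (η : M) ∈ LInv e)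
    (h : lsupp (η : M) ∈ chartDom p) : ∀ᶠ ζ : leftIdeal e in 𝓝 η, lsupp (ζ : M) ∈ chartDom p := by
  obtain ⟨k, hk, -⟩ := exists_isRelInv hη h
  filter_upwards [eventually_chart hη hk] with ζ hζ using hζ.1

lemma contDiffAt_chart_lsupp {p e : Proj M} {η : leftIdeal e} (hη : (η : M) ∈ LInv e)
    (h : lsupp (η : M) ∈ chartDom p) :
    ContDiffAt ℝ ∞ (fun ζ : leftIdeal e => chart p (lsupp (ζ : M))) η := by
  obtain ⟨k, hk, -⟩ := exists_isRelInv hη h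
  have h1 := (contDiff_coe_submodule (leftIdeal e) (n := ∞)).contDiffAt (x := η)
  have h2 : ContDiffAt ℝ ∞ (fun ζ : leftIdeal e =>
      projA p (ζ * k * Ring.inverse ((p : M) * ζ * k + (1 - (p : M))))) η := by
    refine (projA p).contDiff.contDiffAt.comp η ((h1.mul contDiffAt_const).mul
      (contDiffAt_inverse (((contDiffAt_const.mul h1).mul contDiffAt_const).add
        contDiffAt_const) ?_))
    rw [hk.mul_eq]; simp
  refine h2.congr_of_eventuallyEq ?_
  filter_upwards [eventually_chart hη hk] with ζ hζ using hζ.2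

/-- The tangent map of the left support in the chart at `p`. -/
lemma hasFDerivAt_chart_lsupp {p e : Proj M} {η : leftIdeal e} (hη : (η : M) ∈ LInv e)
    (h : lsupp (η : M) ∈ chartDom p) :
    ∃ D : leftIdeal e →L[ℝ] chartSpace p,
      HasFDerivAt (fun ζ : leftIdeal e => chart p (lsupp (ζ : M))) D η ∧
      ∀ x : M, D (projL e (x * η)) = coordA p (chart p (lsupp (η : M))) x := by
  obtain ⟨k, hk, hkσ⟩ := exists_isRelInv hη h
  have h1 : HasFDerivAt (fun ζ : leftIdeal e => (ζ : M)) (leftIdeal e).subtypeL η :=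
    (leftIdeal e).subtypeL.hasFDerivAt
  have hu := ((h1.const_mul (p : M)).mul_const' k).add_const (1 - (p : M))
  -- The element inverted is `1` at `η`, where inversion has derivative `h ↦ -h`. With `σ = ηk`, the
  -- direction `xη` therefore contributes `xσ - σp xσ = (1 - σ)xσ`, which is the coordinate `a_p`.
  have hinv := hasFDerivAt_ringInverse (𝕜 := ℝ) (1 : Mˣ)
  rw [Units.val_one, show (1 : M) = (p : M) * η * k + (1 - (p : M)) by rw [hk.mul_eq]; simp] at hinv
  have h3 := (projA p).hasFDerivAt.comp η ((h1.mul_const' k).mul' (hinv.comp η hu))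
  refine ⟨_, h3.congr_of_eventuallyEq ?_, fun x => ?_⟩
  · filter_upwards [eventually_chart hη hk] with ζ hζ using hζ.2
  · rw [coordA_eq, ← hkσ]
    have h4 : (p : M) * η * k + (1 - p) = 1 := by rw [hk.mul_eq]; simp
    have h5 : (projL e (x * η) : M) = x * η := by
      rw [coe_projL, mul_assoc]
      congr 1
      exact η.2
    have h6 : (η : M) * k * p = η * k := by rw [mul_assoc, hk.mul_right]
    simp only [ContinuousLinearMap.comp_apply]
    congr 1
    simp [h4, h5]
    rw [← mul_assoc, ← mul_assoc, ← mul_assoc, h6]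
    noncomm_ring

end Order

end Smooth

end WStarGroupoid

namespace WStarGroupoid

/-! ### Base atlas, smooth sections, bracket and anchor -/

section Sections

variable {M : Type*} [CStarAlgebra M]

/-- The section `y ↦ p + y` of the left support over the chart domain at `p`. -/
def sigma (p : Proj M) (y : chartSpace p) : leftIdeal p := ⟨(p : M) + y, sigma_mul p y⟩

lemma contDiff_sigma (p : Proj M) {n : ℕ∞ω} : ContDiff ℝ n (sigma p) := by
  have h : sigma p = fun y : chartSpace p => projL p ((p : M) + y) :=
    funext fun y => (projL_coe (sigma p y)).symm
  rw [h]
  exact (projL p).contDiff.comp (contDiff_const.add (contDiff_coe_submodule _))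

lemma contDiff_coe_sigma (p : Proj M) {n : ℕ∞ω} :
    ContDiff ℝ n (fun y : chartSpace p => (p : M) + y) :=
  contDiff_const.add (contDiff_coe_submodule _)

lemma minSmoothness_two_le_infty : minSmoothness ℝ 2 ≤ ∞ := by
  rw [minSmoothness_of_isRCLikeNormedField]
  exact WithTop.coe_le_coe.2 (le_top : (2 : ℕ∞) ≤ ⊤)

lemma unit_mem_LInv (q : Proj M) : (unit q : M) ∈ LInv q := self_mem_LInv q

lemma lsupp_unit (q : Proj M) : lsupp (unit q : M) = q := lsupp_proj q

/-- The type of `X q` depends on `q`, so values at equal base points are compared inside `M`. -/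
lemma coe_section_congr (X : ∀ q : Proj M, leftIdeal q) {q q' : Proj M} (h : q = q') :
    (X q : M) = X q' := by rw [h]

lemma coe_rightInv (e : Proj M) (X : ∀ q : Proj M, leftIdeal q) (η : leftIdeal e) :
    (rightInv e X η : M) = (X (lsupp (η : M)) : M) * η := rfl

lemma rightInv_eq (e : Proj M) (X : ∀ q : Proj M, leftIdeal q) (η : leftIdeal e) :
    rightInv e X η = projL e ((X (lsupp (η : M)) : M) * η) := rightTranslate_eq _ _

lemma rightInv_unit (X : ∀ q : Proj M, leftIdeal q) (q : Proj M) :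
    rightInv q X (unit q) = X q := by
  refine Subtype.ext ?_
  rw [coe_rightInv, coe_section_congr X (lsupp_unit q)]
  exact (X q).2

lemma tangentSet_eq_univ {E : Type*} [NormedAddCommGroup E] [NormedSpace ℝ E] {S : Set E} {η : E}
    (h : S ∈ 𝓝 η) : tangentSet S η = Set.univ := by
  refine Set.eq_univ_of_forall fun v => ⟨fun t => η + t • v, ?_, by simp, ?_, ?_⟩
  · fun_prop
  · have hc : ContinuousAt (fun t : ℝ => η + t • v) 0 := by fun_prop
    exact hc.eventually (by simpa using h)
  · simpa using ((hasDerivAt_id (0 : ℝ)).smul_const v).const_add η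

/-- Right multiplication by `z`, from `Mq` to `Me`. -/
noncomputable def rmulL (q e : Proj M) (z : M) : leftIdeal q →L[ℝ] leftIdeal e :=
  projL e ∘L (ContinuousLinearMap.mul ℝ M).flip z ∘L (leftIdeal q).subtypeL

lemma rmulL_apply (q e : Proj M) (z : M) (x : leftIdeal q) :
    rmulL q e z x = projL e ((x : M) * z) := rfl

lemma coe_rmulL {q e : Proj M} {z : M} (hz : z * e = z) (x : leftIdeal q) :
    (rmulL q e z x : M) = x * z := by
  rw [rmulL_apply, coe_projL, mul_assoc, hz]

lemma rightTranslate_eq_rmulL {e q : Proj M} (η : leftIdeal e) (x : leftIdeal q) :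
    rightTranslate η x = rmulL q e (η : M) x := rightTranslate_eq _ _

section Order

variable [PartialOrder M] [StarOrderedRing M]

lemma chart_lsupp_sigma (p : Proj M) (y : chartSpace p) :
    chart p (lsupp (sigma p y : M)) = y := chart_chartInv p y

lemma sigma_coe_mem_LInv (p : Proj M) (y : chartSpace p) : (sigma p y : M) ∈ LInv p :=
  sigma_mem_LInv p y

/-- The transition map factors as the smooth section `y ↦ p + y` followed by the chart of the left
support. -/
lemma contDiffAt_chart_chartInv {p p' : Proj M} {y : chartSpace p} (h : chartInv p y ∈ chartDom p') :
    ContDiffAt ℝ ∞ (fun y => chart p' (chartInv p y)) y :=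
  (contDiffAt_chart_lsupp (sigma_coe_mem_LInv p y) h).comp y (contDiff_sigma p).contDiffAt

lemma isOpen_chartInv_preimage (p p' : Proj M) :
    IsOpen {y : chartSpace p | chartInv p y ∈ chartDom p'} := by
  rw [isOpen_iff_mem_nhds]
  intro y hy
  exact (contDiff_sigma p (n := 0)).continuous.continuousAt.eventually
    (eventually_lsupp_mem_chartDom (sigma_coe_mem_LInv p y) hy)

theorem isBaseAtlas (p₀ : Proj M) : IsBaseAtlas p₀ := fun p hp =>
  ⟨⟨mem_chartDom_self p, chartDom_subset_orbit hp⟩,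
    fun y => ⟨(isChartSec_chartInv p y).mem_chartDom, chart_chartInv p y⟩,
    fun _ hq => (isChartSec_of_mem_chartDom hq).chartInv_chart,
    fun p' _ => ⟨isOpen_chartInv_preimage p p',
      fun _ hy => (contDiffAt_chart_chartInv hy).contDiffWithinAt⟩⟩

/-! ### Smooth sections -/

/-- The family `X` is smooth as a function on the source fibres of the groupoid. -/
def IsSmoothFamily (p₀ : Proj M) (X : ∀ q : Proj M, leftIdeal q) : Prop :=
  ∀ e ∈ orbit p₀, ∀ η : leftIdeal e, (η : M) ∈ LInv e →
    ContDiffAt ℝ ∞ (fun ζ : leftIdeal e => (X (lsupp (ζ : M)) : M)) η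

/-- A chart-free test of smoothness. Near `η`, in the chart at `p = l(η)`, a section is recovered
from its coordinates as `(a + σb) l(ζ)`, each factor being smooth in `ζ`; conversely the coordinates
arise by pulling back along `y ↦ p + y`. -/
lemma contDiff_bundleCoord_iff {p₀ : Proj M} {X : ∀ q : Proj M, leftIdeal q} :
    (∀ p ∈ orbit p₀, ContDiff ℝ ∞ (fun y => bundleCoord p y (X (chartInv p y) : M))) ↔
      IsSmoothFamily p₀ X := by
  constructor
  · intro h e he η hη
    set p := lsupp (η : M) with hp
    have hpd : lsupp (η : M) ∈ chartDom p := mem_chartDom_self p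
    have hF := contDiffAt_chart_lsupp hη hpd
    have hb : ContDiffAt ℝ ∞ (fun ζ : leftIdeal e => bundleCoord p (chart p (lsupp (ζ : M)))
        (X (chartInv p (chart p (lsupp (ζ : M)))) : M)) η :=
      (h p (LInv.lsupp_mem_orbit he hη)).contDiffAt.comp η hF
    have hσ : ContDiffAt ℝ ∞ (fun ζ : leftIdeal e => (p : M) + chart p (lsupp (ζ : M))) η :=
      (contDiff_coe_sigma p).contDiffAt.comp η hF
    have ha := (contDiff_coe_submodule (chartSpace p)).contDiffAt.comp η
      (contDiff_fst.contDiffAt.comp η hb)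
    have hb' := (contDiff_coe_submodule (corner p)).contDiffAt.comp η
      (contDiff_snd.contDiffAt.comp η hb)
    refine ((ha.add (hσ.mul hb')).mul (contDiffAt_coe_lsupp hη)).congr_of_eventuallyEq ?_
    filter_upwards [eventually_LInv hη, eventually_lsupp_mem_chartDom hη hpd] with ζ hζ hζp
    have hinv := (isChartSec_of_mem_chartDom hζp).chartInv_chart
    have := eq_of_bundleCoord (p := p) (y := chart p (lsupp (ζ : M)))
      (X (chartInv p (chart p (lsupp (ζ : M))))).2
    rw [coe_section_congr X hinv, hinv] at this
    refine this.trans ?_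
    simp only [Function.comp_apply, coe_section_congr X hinv]
    rfl
  · intro h p hp
    rw [contDiff_iff_contDiffAt]
    intro y
    have hX : ContDiffAt ℝ ∞ (fun y => (X (chartInv p y) : M)) y :=
      (h p hp (sigma p y) (sigma_coe_mem_LInv p y)).comp y (contDiff_sigma p).contDiffAt
    have hσ := (contDiff_coe_sigma p (n := ∞)).contDiffAt (x := y)
    simp only [bundleCoord, coordA_eq, coordB_eq]
    exact ((projA p).contDiff.contDiffAt.comp y (((contDiffAt_const.sub hσ).mul hX).mul hσ)).prodMk
      ((projB p).contDiff.contDiffAt.comp y (hX.mul hσ))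

lemma IsSection.isSmoothFamily {p₀ : Proj M} {E : ∀ q : Proj M, Set (leftIdeal q)}
    {X : ∀ q : Proj M, leftIdeal q} (h : IsSection p₀ E X) : IsSmoothFamily p₀ X :=
  contDiff_bundleCoord_iff.1 h.2

lemma mem_nhds_sourceFibre {p₀ e : Proj M} (he : e ∈ orbit p₀) {η : leftIdeal e}
    (hη : (η : M) ∈ LInv e) : sourceFibre (groupoidG p₀) e ∈ 𝓝 η := by
  filter_upwards [eventually_LInv hη] with ζ hζ using (mem_sourceFibre_groupoidG_iff he).2 hζ

lemma algA_eq_univ {p₀ q : Proj M} (hq : q ∈ orbit p₀) : algA p₀ q = Set.univ :=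
  tangentSet_eq_univ (mem_nhds_sourceFibre hq (unit_mem_LInv q))

lemma isSection_algA_iff {p₀ : Proj M} {X : ∀ q : Proj M, leftIdeal q} :
    IsSection p₀ (algA p₀) X ↔ IsSmoothFamily p₀ X :=
  ⟨fun h => h.isSmoothFamily, fun h => ⟨fun q hq => by rw [algA_eq_univ hq]; trivial,
    contDiff_bundleCoord_iff.2 h⟩⟩

lemma IsSmoothFamily.contDiffAt_rightInv {p₀ e : Proj M} {X : ∀ q : Proj M, leftIdeal q}
    (h : IsSmoothFamily p₀ X) (he : e ∈ orbit p₀) {η : leftIdeal e} (hη : (η : M) ∈ LInv e) :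
    ContDiffAt ℝ ∞ (rightInv e X) η := by
  have := (projL e).contDiff.contDiffAt.comp η
    ((h e he η hη).mul (contDiff_coe_submodule _).contDiffAt)
  refine this.congr_of_eventuallyEq (Filter.Eventually.of_forall fun ζ => rightInv_eq e X ζ)

lemma IsSmoothFamily.differentiableAt_rightInv {p₀ e : Proj M} {X : ∀ q : Proj M, leftIdeal q}
    (h : IsSmoothFamily p₀ X) (he : e ∈ orbit p₀) {η : leftIdeal e} (hη : (η : M) ∈ LInv e) :
    DifferentiableAt ℝ (rightInv e X) η :=
  (h.contDiffAt_rightInv he hη).differentiableAt (by simp)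

lemma IsSmoothFamily.add {p₀ : Proj M} {X Y : ∀ q : Proj M, leftIdeal q}
    (hX : IsSmoothFamily p₀ X) (hY : IsSmoothFamily p₀ Y) : IsSmoothFamily p₀ (X + Y) :=
  fun e he η hη => (hX e he η hη).add (hY e he η hη)

lemma IsSmoothOnBase.contDiffAt_lsupp {p₀ e : Proj M} {f : Proj M → ℝ} (hf : IsSmoothOnBase p₀ f)
    (he : e ∈ orbit p₀) {η : leftIdeal e} (hη : (η : M) ∈ LInv e) :
    ContDiffAt ℝ ∞ (fun ζ : leftIdeal e => f (lsupp (ζ : M))) η := by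
  have hpd := mem_chartDom_self (lsupp (η : M))
  refine ((hf _ (LInv.lsupp_mem_orbit he hη)).contDiffAt.comp η
    (contDiffAt_chart_lsupp hη hpd)).congr_of_eventuallyEq ?_
  filter_upwards [eventually_lsupp_mem_chartDom hη hpd] with ζ hζ
  simp only [Function.comp_apply, (isChartSec_of_mem_chartDom hζ).chartInv_chart]

lemma IsSmoothFamily.smul {p₀ : Proj M} {f : Proj M → ℝ} {X : ∀ q : Proj M, leftIdeal q}
    (hf : IsSmoothOnBase p₀ f) (hX : IsSmoothFamily p₀ X) :
    IsSmoothFamily p₀ (fun q => f q • X q) :=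
  fun e he η hη => (hf.contDiffAt_lsupp he hη).smul (hX e he η hη)

/-! ### The bracket -/

/-- Since `l(xη) = l(x)`, the linear map `x ↦ xη` intertwines the right-invariant fields on the two
source fibres. Differentiate this identity at the unit, which goes to `η`. -/
lemma fderiv_rightInv_rmulL {p₀ e q : Proj M} {X : ∀ q : Proj M, leftIdeal q}
    (hX : IsSmoothFamily p₀ X) (he : e ∈ orbit p₀) {η : leftIdeal e} (hη : (η : M) ∈ LInv e)
    (hq : lsupp (η : M) = q) (v : leftIdeal q) :
    fderiv ℝ (rightInv e X) η (rmulL q e (η : M) v) =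
      rmulL q e (η : M) (fderiv ℝ (rightInv q X) (unit q) v) := by
  have hqo : q ∈ orbit p₀ := hq ▸ LInv.lsupp_mem_orbit he hη
  have hR : rmulL q e (η : M) (unit q) = η :=
    Subtype.ext ((coe_rmulL hη.1 _).trans (hq ▸ LInv.lsupp_mul hη))
  have hev : rightInv e X ∘ rmulL q e (η : M) =ᶠ[𝓝 (unit q)]
      rmulL q e (η : M) ∘ rightInv q X := by
    filter_upwards [eventually_LInv (unit_mem_LInv q)] with x hx
    refine Subtype.ext ?_
    have h1 : lsupp ((rmulL q e (η : M) x : leftIdeal e) : M) = lsupp (x : M) := by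
      rw [coe_rmulL hη.1]; exact LInv.lsupp_mul_eq hη (hq ▸ hx)
    simp only [Function.comp_apply]
    rw [coe_rmulL hη.1, coe_rightInv, coe_rightInv, coe_section_congr X h1, coe_rmulL hη.1,
      mul_assoc]
  have h1 : HasFDerivAt (rightInv e X ∘ rmulL q e (η : M))
      (fderiv ℝ (rightInv e X) η ∘L rmulL q e (η : M)) (unit q) := by
    refine HasFDerivAt.comp (unit q) ?_ (rmulL q e (η : M)).hasFDerivAt
    rw [hR]
    exact (hX.differentiableAt_rightInv he hη).hasFDerivAt
  have h2 : HasFDerivAt (rmulL q e (η : M) ∘ rightInv q X)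
      (rmulL q e (η : M) ∘L fderiv ℝ (rightInv q X) (unit q)) (unit q) :=
    (rmulL q e (η : M)).hasFDerivAt.comp (unit q)
      (hX.differentiableAt_rightInv hqo (unit_mem_LInv q)).hasFDerivAt
  exact congrArg (· v) (h1.unique (h2.congr_of_eventuallyEq hev))

/-- The right-invariant vector fields are closed under the Lie bracket. -/
lemma lieBracket_rightInv {p₀ e : Proj M} {X Y : ∀ q : Proj M, leftIdeal q}
    (hX : IsSmoothFamily p₀ X) (hY : IsSmoothFamily p₀ Y) (he : e ∈ orbit p₀) {η : leftIdeal e}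
    (hη : (η : M) ∈ LInv e) :
    VectorField.lieBracket ℝ (rightInv e X) (rightInv e Y) η = rightInv e (bracket X Y) η := by
  have hr : ∀ Z : (∀ q : Proj M, leftIdeal q), rightInv e Z η = rmulL _ e (η : M) (Z _) :=
    fun Z => rightTranslate_eq_rmulL _ _
  rw [hr (bracket X Y)]
  simp only [VectorField.lieBracket, bracket]
  rw [hr, hr, fderiv_rightInv_rmulL hX he hη rfl,
    fderiv_rightInv_rmulL hY he hη rfl, ← map_sub,
    rightInv_unit, rightInv_unit]

/-- The bracket field at `ζ` is `[X,Y](l(ζ)) ζ`. Multiplying by the smooth function `ginv e ζ`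
recovers the section, as `ζ * ginv e ζ = l(ζ)`. -/
lemma IsSmoothFamily.bracket {p₀ : Proj M} {X Y : ∀ q : Proj M, leftIdeal q}
    (hX : IsSmoothFamily p₀ X) (hY : IsSmoothFamily p₀ Y) :
    IsSmoothFamily p₀ (bracket X Y) := by
  intro e he η hη
  have h1 : ContDiffAt ℝ ∞ (VectorField.lieBracket ℝ (rightInv e X) (rightInv e Y)) η :=
    (hX.contDiffAt_rightInv he hη).lieBracket_vectorField (hY.contDiffAt_rightInv he hη) (by simp)
  refine (((contDiff_coe_submodule _).contDiffAt.comp η h1).mul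
    (contDiffAt_ginv hη)).congr_of_eventuallyEq ?_
  filter_upwards [eventually_LInv hη] with ζ hζ
  rw [Function.comp_apply, lieBracket_rightInv hX hY he hζ, coe_rightInv, mul_assoc,
    ← LInv.coe_lsupp hζ]
  exact (WStarGroupoid.bracket X Y (lsupp (ζ : M))).2.symm

/-! ### The anchor -/

lemma fderiv_chart_lsupp {p e : Proj M} {η : leftIdeal e} (hη : (η : M) ∈ LInv e)
    (h : lsupp (η : M) ∈ chartDom p) (x : M) :
    fderiv ℝ (fun ζ : leftIdeal e => chart p (lsupp (ζ : M))) η (projL e (x * η)) =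
      coordA p (chart p (lsupp (η : M))) x := by
  obtain ⟨D, hD, hDx⟩ := hasFDerivAt_chart_lsupp hη h
  rw [hD.fderiv, hDx]

lemma differentiableAt_chart_lsupp {p e : Proj M} {η : leftIdeal e} (hη : (η : M) ∈ LInv e)
    (h : lsupp (η : M) ∈ chartDom p) :
    DifferentiableAt ℝ (fun ζ : leftIdeal e => chart p (lsupp (ζ : M))) η :=
  (contDiffAt_chart_lsupp hη h).differentiableAt (by simp)

lemma hasFDerivAt_anchor {p q : Proj M} (h : q ∈ chartDom p) :
    HasFDerivAt (fun ζ : leftIdeal q => chart p (lsupp (ζ : M))) (anchor p q) (unit q) :=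
  (differentiableAt_chart_lsupp (unit_mem_LInv q) (by rwa [lsupp_unit])).hasFDerivAt

lemma anchor_apply {p q : Proj M} (h : q ∈ chartDom p) (x : leftIdeal q) :
    anchor p q x = coordA p (chart p q) x := by
  have := fderiv_chart_lsupp (unit_mem_LInv q) (by rwa [lsupp_unit]) (x : M) (p := p)
  rw [lsupp_unit, show projL q ((x : M) * (unit q : M)) = x from
    Subtype.ext (by rw [coe_projL, mul_assoc]; exact (congrArg _ q.mul_self).trans x.2)] at this
  exact this

lemma anchorField_apply (p : Proj M) (X : ∀ q : Proj M, leftIdeal q) (y : chartSpace p) :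
    anchorField p X y = coordA p y (X (chartInv p y)) := by
  rw [anchorField, anchor_apply (isChartSec_chartInv p y).mem_chartDom, chart_chartInv]

lemma IsSection.contDiff_anchorField {p₀ p : Proj M} {E : ∀ q : Proj M, Set (leftIdeal q)}
    {X : ∀ q : Proj M, leftIdeal q} (h : IsSection p₀ E X) (hp : p ∈ orbit p₀) :
    ContDiff ℝ ∞ (anchorField p X) := by
  rw [funext (anchorField_apply p X)]
  exact contDiff_fst.comp (h.2 p hp)

/-- The right-invariant fields and their anchors are related by the left support. -/
lemma fderiv_chart_rightInv {p e : Proj M} {η : leftIdeal e} (hη : (η : M) ∈ LInv e)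
    (h : lsupp (η : M) ∈ chartDom p) (X : ∀ q : Proj M, leftIdeal q) :
    fderiv ℝ (fun ζ : leftIdeal e => chart p (lsupp (ζ : M))) η (rightInv e X η) =
      anchorField p X (chart p (lsupp (η : M))) := by
  rw [rightInv_eq, fderiv_chart_lsupp hη h, anchorField_apply,
    coe_section_congr X (isChartSec_of_mem_chartDom h).chartInv_chart]

/-- Fields related by a smooth map have related brackets, by symmetry of its second derivative. Here
the map is the chart of `l` on the source fibre of `p`, evaluated at `p + y`. -/
lemma anchorField_bracket {p₀ p : Proj M} {E : ∀ q : Proj M, Set (leftIdeal q)}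
    {X Y : ∀ q : Proj M, leftIdeal q} (hX : IsSection p₀ E X) (hY : IsSection p₀ E Y)
    (hp : p ∈ orbit p₀) (y : chartSpace p) :
    anchorField p (bracket X Y) y =
      VectorField.lieBracket ℝ (anchorField p X) (anchorField p Y) y := by
  have hη := sigma_coe_mem_LInv p y
  have hd : lsupp (sigma p y : M) ∈ chartDom p := (isChartSec_chartInv p y).mem_chartDom
  have h1 := fderiv_chart_rightInv hη hd
  have hc : ∀ Z, IsSection p₀ E Z → ∀ v,
      fderiv ℝ (fun ζ : leftIdeal p => fderiv ℝ (fun ζ : leftIdeal p => chart p (lsupp (ζ : M))) ζ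
        (rightInv p Z ζ)) (sigma p y) v = fderiv ℝ (anchorField p Z) y
          (fderiv ℝ (fun ζ : leftIdeal p => chart p (lsupp (ζ : M))) (sigma p y) v) := by
    intro Z hZ v
    have hev : (fun ζ : leftIdeal p => fderiv ℝ (fun ζ : leftIdeal p => chart p (lsupp (ζ : M))) ζ
        (rightInv p Z ζ)) =ᶠ[𝓝 (sigma p y)]
          anchorField p Z ∘ fun ζ : leftIdeal p => chart p (lsupp (ζ : M)) := by
      filter_upwards [eventually_LInv hη, eventually_lsupp_mem_chartDom hη hd] with ζ h2 h3
      exact fderiv_chart_rightInv h2 h3 Z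
    rw [hev.fderiv_eq, fderiv_comp _ ((hZ.contDiff_anchorField hp).differentiable (by simp) _)
      (differentiableAt_chart_lsupp hη hd), chart_lsupp_sigma]
    rfl
  have h2 := VectorField.fderiv_apply_lieBracket (𝕜 := ℝ) (contDiffAt_chart_lsupp hη hd)
    (n := ∞) minSmoothness_two_le_infty (hY.isSmoothFamily.differentiableAt_rightInv hp hη)
    (hX.isSmoothFamily.differentiableAt_rightInv hp hη)
  rw [lieBracket_rightInv hX.isSmoothFamily hY.isSmoothFamily hp hη, h1, hc X hX, hc Y hY, h1, h1,
    chart_lsupp_sigma] at h2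
  exact h2

/-- The field of `fY` is `f ∘ l` times the field of `Y`. By the chain rule, the derivative of `f ∘
l` along the field of `X` is that of `f` along the anchor of `X`. -/
lemma bracket_smul_right {p₀ p : Proj M} {f : Proj M → ℝ} {X Y : ∀ q : Proj M, leftIdeal q}
    (hf : IsSmoothOnBase p₀ f) (hY : IsSmoothFamily p₀ Y)
    (hp : p ∈ orbit p₀) (y : chartSpace p) :
    bracket X (fun q => f q • Y q) (chartInv p y) =
      f (chartInv p y) • bracket X Y (chartInv p y) +
        fderiv ℝ (fun y' => f (chartInv p y')) y (anchorField p X y) • Y (chartInv p y) := by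
  set q := chartInv p y with hq
  have hqo : q ∈ orbit p₀ := chartInv_mem_orbit hp y
  have hqd : q ∈ chartDom p := (isChartSec_chartInv p y).mem_chartDom
  have hu := unit_mem_LInv q
  have hud : lsupp (unit q : M) ∈ chartDom p := by rwa [lsupp_unit]
  have hchart : chart p (lsupp (unit q : M)) = y := by rw [lsupp_unit, hq, chart_chartInv]
  have h1 : rightInv q (fun q => f q • Y q) =
      fun ζ : leftIdeal q => f (lsupp (ζ : M)) • rightInv q Y ζ :=
    funext fun ζ => Subtype.ext (smul_mul_assoc _ _ _)
  have hev : (fun ζ : leftIdeal q => f (lsupp (ζ : M))) =ᶠ[𝓝 (unit q)]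
      (fun y' => f (chartInv p y')) ∘ fun ζ : leftIdeal q => chart p (lsupp (ζ : M)) := by
    filter_upwards [eventually_lsupp_mem_chartDom hu hud] with ζ hζ
    simp only [Function.comp_apply, (isChartSec_of_mem_chartDom hζ).chartInv_chart]
  have h2 : fderiv ℝ (fun ζ : leftIdeal q => f (lsupp (ζ : M))) (unit q) (rightInv q X (unit q)) =
      fderiv ℝ (fun y' => f (chartInv p y')) y (anchorField p X y) := by
    rw [hev.fderiv_eq, fderiv_comp _ ((hf p hp).differentiable (by simp) _)
      (differentiableAt_chart_lsupp hu hud), ContinuousLinearMap.comp_apply,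
      fderiv_chart_rightInv hu hud, hchart]
  rw [bracket, h1, VectorField.lieBracket_smul_right
    ((hf.contDiffAt_lsupp hqo hu).differentiableAt (by simp))
    (hY.differentiableAt_rightInv hqo hu), h2, rightInv_unit, lsupp_unit, add_comm]
  rfl

/-- Near the unit the field of an inner bracket is the Lie bracket of the fields, so the identity is
the one for vector fields on an open subset of `Mq`. -/
lemma bracket_jacobi {p₀ q : Proj M} {X Y Z : ∀ q : Proj M, leftIdeal q}
    (hX : IsSmoothFamily p₀ X) (hY : IsSmoothFamily p₀ Y) (hZ : IsSmoothFamily p₀ Z)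
    (hq : q ∈ orbit p₀) :
    bracket X (bracket Y Z) q + bracket Y (bracket Z X) q + bracket Z (bracket X Y) q = 0 := by
  have hu := unit_mem_LInv q
  have key : ∀ A B C : (∀ q : Proj M, leftIdeal q), IsSmoothFamily p₀ B → IsSmoothFamily p₀ C →
      bracket A (bracket B C) q = VectorField.lieBracket ℝ (rightInv q A)
        (VectorField.lieBracket ℝ (rightInv q B) (rightInv q C)) (unit q) := by
    intro A B C hB hC
    refine Filter.EventuallyEq.lieBracket_vectorField_eq Filter.EventuallyEq.rfl ?_
    filter_upwards [eventually_LInv hu] with ζ hζ using (lieBracket_rightInv hB hC hq hζ).symm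
  rw [key X Y Z hY hZ, key Y Z X hZ hX, key Z X Y hX hY,
    VectorField.leibniz_identity_lieBracket (n := ∞) minSmoothness_two_le_infty
      (hX.contDiffAt_rightInv hq hu)
      (hY.contDiffAt_rightInv hq hu) (hZ.contDiffAt_rightInv hq hu),
    VectorField.lieBracket_swap (V := rightInv q Z)]
  have : VectorField.lieBracket ℝ (rightInv q Z) (rightInv q X) =
      -VectorField.lieBracket ℝ (rightInv q X) (rightInv q Z) :=
    funext fun _ => VectorField.lieBracket_swap
  have h3 : ∀ V W : leftIdeal q → leftIdeal q, VectorField.lieBracket ℝ V (-W) (unit q) =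
      -VectorField.lieBracket ℝ V W (unit q) := by
    intro V W
    simp only [VectorField.lieBracket, fderiv_neg, Pi.neg_apply, map_neg,
      neg_apply]
    abel
  rw [this, h3]
  abel

/-- A subbundle of the algebroid of the groupoid whose sections are closed under the bracket
is a Lie algebroid. -/
lemma isLieAlgebroid_of_bracket_mem {p₀ : Proj M} {E : ∀ q : Proj M, Set (leftIdeal q)}
    (hadd : ∀ q ∈ orbit p₀, ∀ x ∈ E q, ∀ z ∈ E q, x + z ∈ E q)
    (hsmul : ∀ q ∈ orbit p₀, ∀ c : ℝ, ∀ x ∈ E q, c • x ∈ E q)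
    (hbr : ∀ X Y, IsSection p₀ E X → IsSection p₀ E Y → ∀ q ∈ orbit p₀, bracket X Y q ∈ E q) :
    IsLieAlgebroid p₀ E where
  add_mem X Y hX hY := ⟨fun q hq => hadd q hq _ (hX.1 q hq) _ (hY.1 q hq),
    contDiff_bundleCoord_iff.2 (hX.isSmoothFamily.add hY.isSmoothFamily)⟩
  smul_mem f X hf hX := ⟨fun q hq => hsmul q hq _ _ (hX.1 q hq),
    contDiff_bundleCoord_iff.2 (hX.isSmoothFamily.smul hf)⟩
  bracket_mem X Y hX hY := ⟨hbr X Y hX hY,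
    contDiff_bundleCoord_iff.2 (hX.isSmoothFamily.bracket hY.isSmoothFamily)⟩
  bracket_add X Y Z _ hY hZ q hq := by
    have h : rightInv q (Y + Z) = rightInv q Y + rightInv q Z :=
      funext fun ζ => Subtype.ext (add_mul _ _ _)
    rw [bracket, h, VectorField.lieBracket_add_right
      (hY.isSmoothFamily.differentiableAt_rightInv hq (unit_mem_LInv q))
      (hZ.isSmoothFamily.differentiableAt_rightInv hq (unit_mem_LInv q))]
    rfl
  bracket_smul c X Y _ hY q hq := by
    have h : rightInv q (c • Y) = c • rightInv q Y :=
      funext fun ζ => Subtype.ext (smul_mul_assoc _ _ _)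
    rw [bracket, h, VectorField.lieBracket_const_smul_right
      (hY.isSmoothFamily.differentiableAt_rightInv hq (unit_mem_LInv q))]
    rfl
  bracket_swap _ _ _ _ _ _ := VectorField.lieBracket_swap
  jacobi _ _ _ hX hY hZ _ hq :=
    bracket_jacobi hX.isSmoothFamily hY.isSmoothFamily hZ.isSmoothFamily hq
  leibniz _ _ _ hf _ hY _ hp y := bracket_smul_right hf hY.isSmoothFamily hp y
  anchor_bracket _ _ hX hY _ hp y := anchorField_bracket hX hY hp y

theorem isLieAlgebroid_algA (p₀ : Proj M) : IsLieAlgebroid p₀ (algA p₀) := by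
  have h : ∀ q ∈ orbit p₀, ∀ x, x ∈ algA p₀ q := fun q hq x => by
    rw [algA_eq_univ hq]; trivial
  exact isLieAlgebroid_of_bracket_mem (fun q hq _ _ _ _ => h q hq _) (fun q hq _ _ _ => h q hq _)
    fun _ _ _ _ q hq => h q hq _

end Order

end Sections

end WStarGroupoid

namespace WStarGroupoid

/-! ### Transition maps of the bundle, and the algebroid of partial isometries -/

section Unitary

variable {M : Type*} [CStarAlgebra M]

/-- Left multiplication by `z`. -/
noncomputable def lmulL (z : M) : M →L[ℝ] M := ContinuousLinearMap.mul ℝ M z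

/-- Right multiplication by `z`. -/
noncomputable def rmul (z : M) : M →L[ℝ] M := (ContinuousLinearMap.mul ℝ M).flip z

@[simp] lemma lmulL_apply (z x : M) : lmulL z x = z * x := rfl

@[simp] lemma rmul_apply (z x : M) : rmul z x = x * z := rfl

lemma contDiff_lmulL {n : ℕ∞ω} : ContDiff ℝ n (lmulL : M → M →L[ℝ] M) :=
  (ContinuousLinearMap.mul ℝ M).contDiff

lemma contDiff_rmul {n : ℕ∞ω} : ContDiff ℝ n (rmul : M → M →L[ℝ] M) :=
  (ContinuousLinearMap.mul ℝ M).flip.contDiff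

/-- The first component of a vector of the model space. -/
noncomputable def modelA (p : Proj M) : Model p →L[ℝ] M :=
  (chartSpace p).subtypeL ∘L ContinuousLinearMap.fst ℝ (chartSpace p) (corner p)

/-- The second component of a vector of the model space. -/
noncomputable def modelB (p : Proj M) : Model p →L[ℝ] M :=
  (corner p).subtypeL ∘L ContinuousLinearMap.snd ℝ (chartSpace p) (corner p)

@[simp] lemma modelA_apply (p : Proj M) (v : Model p) : modelA p v = v.1 := rfl

@[simp] lemma modelB_apply (p : Proj M) (v : Model p) : modelB p v = v.2 := rfl

section Order

variable [PartialOrder M] [StarOrderedRing M]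

/-- The change of bundle charts from `p` to `p'`. -/
noncomputable def transition (p p' : Proj M) (y : chartSpace p) : Model p →L[ℝ] Model p' :=
  (ContinuousLinearMap.inl ℝ (chartSpace p') (corner p') ∘L projA p' ∘L
      lmulL (1 - (p' + chart p' (chartInv p y))) +
    ContinuousLinearMap.inr ℝ (chartSpace p') (corner p') ∘L projB p') ∘L
  rmul (p' + chart p' (chartInv p y)) ∘L (modelA p + lmulL ((p : M) + y) ∘L modelB p)

theorem isBanachBundle_algA (p₀ : Proj M) : IsBanachBundle p₀ (algA p₀) := by
  intro p hp
  refine ⟨fun y => ?_, fun p' _ => ⟨transition p p', fun y hy => ?_, fun y hy x _ => ?_⟩⟩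
  · rw [algA_eq_univ (chartInv_mem_orbit hp y)]
    refine ⟨fun _ _ => trivial, fun x _ x' _ hxx' => Subtype.ext ?_, fun v _ => ?_⟩
    · have h := Prod.mk.inj hxx'
      rw [eq_of_bundleCoord x.2, eq_of_bundleCoord x'.2, h.1, h.2]
    · refine ⟨⟨(v.1 + (p + y) * v.2) * (chartInv p y : M), ?_⟩, trivial,
        bundleCoord_mul_chartInv v.1 v.2⟩
      change _ * (chartInv p y : M) = _
      rw [mul_assoc, (chartInv p y).mul_self]
  · refine ContDiffAt.contDiffWithinAt ?_
    have hσ' : ContDiffAt ℝ ∞ (fun y => (p' : M) + chart p' (chartInv p y)) y :=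
      (contDiff_coe_sigma p').contDiffAt.comp y (contDiffAt_chart_chartInv hy)
    have hσ := (contDiff_coe_sigma p (n := ∞)).contDiffAt (x := y)
    have h1 := contDiff_lmulL.contDiffAt.comp y
      ((contDiffAt_const (c := (1 : M))).sub hσ')
    have h2 := contDiff_rmul.contDiffAt.comp y hσ'
    have h3 := contDiff_lmulL.contDiffAt.comp y hσ
    exact ((contDiffAt_const.clm_comp (contDiffAt_const.clm_comp h1)).add
      contDiffAt_const).clm_comp (h2.clm_comp (contDiffAt_const.add
        (h3.clm_comp contDiffAt_const)))
  · have hs := isChartSec_of_mem_chartDom hy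
    set σ' := (p' : M) + chart p' (chartInv p y) with hσ'
    -- Since `qσ' = σ'`, the factor `q` in the reconstruction of `x` is absorbed, and the new
    -- coordinates are linear in `(a, b)`.
    have hx : (x : M) * σ' = (coordA p y x + (p + y) * coordB p y x) * σ' := by
      conv_lhs => rw [eq_of_bundleCoord x.2]
      rw [mul_assoc, hs.left_mul]
    rw [bundleCoord, bundleCoord, coordA_eq p', coordB_eq p', mul_assoc _ (x : M), ← hσ', hx]
    simp [transition, ← hσ', add_mul, mul_add]

/-! ### The unitary algebroid -/

/-- Differentiate `γ*γ = q` at the unit. -/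
lemma algU_subset {p₀ q : Proj M} (hq : q ∈ orbit p₀) {x : leftIdeal q} (hx : x ∈ algU p₀ q) :
    (q : M) * x + star (x : M) * q = 0 := by
  obtain ⟨γ, -, h0, hmem, hd⟩ := hx
  have h1 : HasDerivAt (fun t => (γ t : M)) (x : M) 0 :=
    (leftIdeal q).subtypeL.hasFDerivAt.comp_hasDerivAt (0 : ℝ) hd
  have h2 := h1.star.mul h1
  have h3 : HasDerivAt (fun t => star (γ t : M) * γ t) (0 : M) 0 := by
    refine (hasDerivAt_const (0 : ℝ) (q : M)).congr_of_eventuallyEq ?_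
    filter_upwards [hmem] with t ht using (mem_sourceFibre_groupoidU_iff hq).1 ht
  have h4 := h2.unique h3
  rw [h0] at h4
  rw [add_comm]
  simpa [unit, q.star_eq] using h4

lemma mem_algU {p₀ q : Proj M} (hq : q ∈ orbit p₀) {x : leftIdeal q}
    (hx : (q : M) * x + star (x : M) * q = 0) : x ∈ algU p₀ q := by
  have hxq : (x : M) * q = x := x.2
  have hxq' : q * star (x : M) = star (x : M) := by
    have := congrArg star hxq
    rwa [star_mul, q.star_eq] at this
  -- In block form relative to `q`, `x` is a first column with skew-adjoint corner. Subtracting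
  -- `((1-q)x)* = x* + qx` fills the other off-diagonal block and makes `A` skew-adjoint with `Aq =
  -- x`; then `exp(tA)q` is a curve of partial isometries with velocity `x`.
  set A : M := x - star (x : M) - q * x with hA
  have hAs : star A = -A := by
    have h1 : star (x : M) * q = -(q * x) := eq_neg_of_add_eq_zero_right hx
    rw [hA, star_sub, star_sub, star_star, star_mul, q.star_eq, h1]
    abel
  have hAq : A * q = x := by
    have h1 : star (x : M) * q = -(q * x) := eq_neg_of_add_eq_zero_right hx
    rw [hA, sub_mul, sub_mul, mul_assoc, hxq, h1]
    abel
  have hexp : ∀ t : ℝ, star (NormedSpace.exp (t • A)) * NormedSpace.exp (t • A) = 1 := by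
    intro t
    let _ : NormedAlgebra ℚ M := NormedAlgebra.restrictScalars ℚ ℝ M
    rw [NormedSpace.star_exp, star_smul, hAs, star_trivial, smul_neg,
      ← NormedSpace.exp_add_of_commute (Commute.neg_left (Commute.refl _)), neg_add_cancel,
      NormedSpace.exp_zero]
  have hd := hasDerivAt_exp_smul_const (𝕂 := ℝ) A (0 : ℝ)
  have hcd : ContDiffAt ℝ ∞ (fun t : ℝ => NormedSpace.exp (t • A)) 0 :=
    (NormedSpace.exp_analytic (𝕂 := ℝ) ((0 : ℝ) • A)).contDiffAt.comp (0 : ℝ)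
      (contDiffAt_id.smul contDiffAt_const)
  refine ⟨fun t => projL q (NormedSpace.exp (t • A)), ?_, ?_, ?_, ?_⟩
  · exact (projL q).contDiff.contDiffAt.comp (0 : ℝ) hcd
  · refine Subtype.ext ?_
    rw [coe_projL, zero_smul, NormedSpace.exp_zero, one_mul]
    rfl
  · refine Filter.Eventually.of_forall fun t => (mem_sourceFibre_groupoidU_iff hq).2 ?_
    rw [coe_projL, star_mul, q.star_eq, mul_assoc, ← mul_assoc (star _), hexp, one_mul, q.mul_self]
  · have h := (projL q).hasFDerivAt.comp_hasDerivAt (0 : ℝ) hd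
    rwa [show projL q (NormedSpace.exp ((0 : ℝ) • A) * A) = x from Subtype.ext (by
      rw [coe_projL, zero_smul, NormedSpace.exp_zero, one_mul, hAq])] at h

lemma mem_algU_iff {p₀ q : Proj M} (hq : q ∈ orbit p₀) {x : leftIdeal q} :
    x ∈ algU p₀ q ↔ (q : M) * x + star (x : M) * q = 0 :=
  ⟨algU_subset hq, mem_algU hq⟩

/-- The derivative along a unitary direction of a right-invariant field tangent to the groupoid
of partial isometries. -/
lemma fderiv_rightInv_algU {p₀ q : Proj M} {X Y : ∀ q : Proj M, leftIdeal q}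
    (hX : IsSection p₀ (algU p₀) X) (hY : IsSection p₀ (algU p₀) Y) (hq : q ∈ orbit p₀) :
    star (X q : M) * Y q + q * (fderiv ℝ (rightInv q Y) (unit q) (X q) : M) +
      (star (fderiv ℝ (rightInv q Y) (unit q) (X q) : M) * q + star (Y q : M) * X q) = 0 := by
  obtain ⟨γ, -, h0, hmem, hd⟩ := hX.1 q hq
  have hu : (unit q : M) ∈ LInv q := unit_mem_LInv q
  have h1 : HasDerivAt (fun t => (γ t : M)) (X q : M) 0 :=
    (leftIdeal q).subtypeL.hasFDerivAt.comp_hasDerivAt (0 : ℝ) hd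
  have hf : HasFDerivAt (rightInv q Y) (fderiv ℝ (rightInv q Y) (unit q)) (γ 0) := by
    rw [h0]; exact (hY.isSmoothFamily.differentiableAt_rightInv hq hu).hasFDerivAt
  have h2 : HasDerivAt (fun t => (rightInv q Y (γ t) : M))
      (fderiv ℝ (rightInv q Y) (unit q) (X q) : M) 0 :=
    (leftIdeal q).subtypeL.hasFDerivAt.comp_hasDerivAt (0 : ℝ) (hf.comp_hasDerivAt (0 : ℝ) hd)
  have h3 := (h1.star.mul h2).add (h2.star.mul h1)
  -- With `Q = l(γ)`, the function equals `γ*(Q Y + Y* Q)γ`, which is zero because `Y` takes values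
  -- in the unitary fibre over `Q`.
  have h4 : HasDerivAt (fun t => star (γ t : M) * (rightInv q Y (γ t) : M) +
      star (rightInv q Y (γ t) : M) * γ t) (0 : M) 0 := by
    refine (hasDerivAt_const (0 : ℝ) (0 : M)).congr_of_eventuallyEq ?_
    filter_upwards [hmem] with t ht
    have ht' := (mem_sourceFibre_groupoidU_iff hq).1 ht
    have hL : (γ t : M) ∈ LInv q := mem_LInv_of_star_mul_self (γ t).2 ht'
    have hZ := algU_subset (LInv.lsupp_mem_orbit hq hL) (hY.1 _ (LInv.lsupp_mem_orbit hq hL))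
    have h5 := LInv.lsupp_mul hL
    set Q := lsupp (γ t : M) with hQ
    have h6 : star (γ t : M) * Q = star (γ t : M) := by
      have := congrArg star h5
      rwa [star_mul, Q.star_eq] at this
    calc star (γ t : M) * (rightInv q Y (γ t) : M) + star (rightInv q Y (γ t) : M) * γ t
        = star (γ t : M) * Q * (Y Q * γ t) + star ((Y Q : M) * γ t) * (Q * γ t) := by
          rw [h6, h5]; rfl
      _ = star (γ t : M) * (Q * Y Q + star (Y Q : M) * Q) * γ t := by
          rw [star_mul]; noncomm_ring
      _ = 0 := by rw [hZ, mul_zero, zero_mul]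
  have h5 := h3.unique h4
  rw [h0, rightInv_unit] at h5
  simpa [unit, q.star_eq] using h5

/-- The quadratic terms `X*Y + Y*X` are symmetric in `X` and `Y`, so they cancel when the two
derivative identities are subtracted. -/
lemma bracket_mem_algU {p₀ q : Proj M} {X Y : ∀ q : Proj M, leftIdeal q}
    (hX : IsSection p₀ (algU p₀) X) (hY : IsSection p₀ (algU p₀) Y) (hq : q ∈ orbit p₀) :
    bracket X Y q ∈ algU p₀ q := by
  refine mem_algU hq ?_
  have h1 := fderiv_rightInv_algU hX hY hq
  have h2 := fderiv_rightInv_algU hY hX hq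
  simp only [bracket, VectorField.lieBracket, rightInv_unit, Submodule.coe_sub, star_sub]
  rw [← sub_eq_zero.2 (h1.trans h2.symm)]
  noncomm_ring

theorem isLieAlgebroid_algU (p₀ : Proj M) : IsLieAlgebroid p₀ (algU p₀) := by
  refine isLieAlgebroid_of_bracket_mem (fun q hq x hx z hz => ?_) (fun q hq c x hx => ?_)
    fun X Y hX hY q hq => bracket_mem_algU hX hY hq
  · rw [mem_algU_iff hq] at *
    rw [← add_zero (0 : M)]
    nth_rewrite 1 [← hx]
    rw [← hz, Submodule.coe_add, star_add]
    noncomm_ring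
  · rw [mem_algU_iff hq] at *
    rw [Submodule.coe_smul, star_smul, star_trivial, mul_smul_comm, smul_mul_assoc, ← smul_add, hx,
      smul_zero]

/-- The fields are differentiable at the unit in the ambient space `Mq`, so derivatives along curves
in the smaller groupoid depend only on the velocities. -/
lemma isBracketOf_bracket {p₀ q : Proj M} {X Y : ∀ q : Proj M, leftIdeal q}
    (hX : IsSmoothFamily p₀ X) (hY : IsSmoothFamily p₀ Y) (hq : q ∈ orbit p₀) (𝒢 : Set M) :
    IsBracketOf 𝒢 X Y q (bracket X Y q) := by
  rintro γ δ ⟨-, hγ0, -, hγ⟩ ⟨-, hδ0, -, hδ⟩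
  have hu : (unit q : M) ∈ LInv q := unit_mem_LInv q
  have h1 := (hY.differentiableAt_rightInv hq hu).hasFDerivAt
  have h2 := (hX.differentiableAt_rightInv hq hu).hasFDerivAt
  rw [← hγ0] at h1
  rw [← hδ0] at h2
  refine ⟨_, _, h1.comp_hasDerivAt (0 : ℝ) hγ, h2.comp_hasDerivAt (0 : ℝ) hδ, ?_⟩
  rw [hγ0, hδ0]
  simp only [bracket, VectorField.lieBracket, rightInv_unit]

lemma isAnchorOf_anchor {p q : Proj M} (h : q ∈ chartDom p) (𝒢 : Set M) (x : leftIdeal q) :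
    IsAnchorOf 𝒢 p q x (anchor p q x) := by
  rintro γ ⟨-, hγ0, -, hγ⟩
  have h1 := hasFDerivAt_anchor h
  rw [← hγ0] at h1
  exact h1.comp_hasDerivAt (0 : ℝ) hγ

/-- The right inverse is `v ↦ (1-q)vq`: left multiplication by `q` kills it, so the skewness
condition is trivial. The anchor returns `v` because `σq = q`, `qσ = σ`, `σv = 0` and `vσ = v`. -/
theorem isTransitive_algU (p₀ : Proj M) : IsTransitive p₀ (algU p₀) := by
  intro p hp q hq
  refine ⟨projL q ∘L lmulL (1 - (q : M)) ∘L (chartSpace p).subtypeL, fun v => ?_⟩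
  have hs := isChartSec_of_mem_chartDom hq
  have hc : ((projL q ∘L lmulL (1 - (q : M)) ∘L (chartSpace p).subtypeL) v : M) =
      (1 - q) * v * q := rfl
  refine ⟨mem_algU (chartDom_subset_orbit hp hq) ?_, ?_⟩
  · rw [hc]
    have h : (q : M) * (1 - q) = 0 := by rw [mul_sub, mul_one, q.mul_self, sub_self]
    have h' : (1 - (q : M)) * q = 0 := by rw [sub_mul, one_mul, q.mul_self, sub_self]
    rw [star_mul, star_mul, star_sub, star_one, q.star_eq, ← mul_assoc, ← mul_assoc, h,
      mul_assoc (q : M) _ (q : M), mul_assoc (star (v : M)), h']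
    simp
  · rw [anchor_apply hq]
    refine Subtype.ext ?_
    change (1 - ((p : M) + chart p q)) * _ * (p + chart p q) = v
    rw [hc]
    set σ := (p : M) + chart p q
    have h1 : (1 - σ) * (1 - q) = 1 - σ := by
      rw [mul_sub, mul_one, sub_mul, one_mul, hs.mul_proj]; abel
    have hσv : σ * v = 0 := by rw [← hs.mul_right, mul_assoc, mul_chart, mul_zero]
    have hvσ : (v : M) * σ = v := by
      rw [← chart_mul p v, mul_assoc, hs.base_mul]
    rw [mul_assoc, mul_assoc _ (q : M) σ, hs.left_mul, ← mul_assoc (1 - σ),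
      ← mul_assoc (1 - σ), h1, mul_assoc, hvσ, sub_mul, one_mul, hσv, sub_zero]

/-! ### The unitary subbundle -/

/-- The skew-adjoint directions in the model space. -/
def skewModel (p : Proj M) : Submodule ℝ (Model p) where
  carrier := {v | star (v.2 : M) = -v.2}
  add_mem' := by
    intro v w hv hw
    simp only [Set.mem_ofPred_eq] at *
    rw [Prod.snd_add, Submodule.coe_add, star_add, hv, hw, neg_add]
  zero_mem' := by simp
  smul_mem' := by
    intro c v hv
    simp only [Set.mem_ofPred_eq] at *
    rw [Prod.smul_snd, Submodule.coe_smul, star_smul, star_trivial, hv, smul_neg]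

omit [PartialOrder M] [StarOrderedRing M] in
lemma mem_skewModel {p : Proj M} {v : Model p} : v ∈ skewModel p ↔ star (v.2 : M) = -v.2 := Iff.rfl

omit [PartialOrder M] [StarOrderedRing M] in
lemma coe_projB_of_mem {p : Proj M} {z : M} (h1 : p * z = z) (h2 : z * p = z) :
    (projB p z : M) = z := by rw [coe_projB, h1, h2]

omit [PartialOrder M] [StarOrderedRing M] in
-- A bounded projection is `(a, b) ↦ (a, (b - b*)/2)`.
lemma closedComplemented_skewModel (p : Proj M) : (skewModel p).ClosedComplemented := by
  let f : Model p →L[ℝ] Model p :=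
    ContinuousLinearMap.inl ℝ (chartSpace p) (corner p) ∘L ContinuousLinearMap.fst ℝ _ _ +
    ContinuousLinearMap.inr ℝ (chartSpace p) (corner p) ∘L projB p ∘L
      ((1 / 2 : ℝ) • (ContinuousLinearMap.id ℝ M -
        ((starL' ℝ : M ≃L[ℝ] M) : M →L[ℝ] M)) ∘L modelB p)
  have hf : ∀ v, ((f v).2 : M) = (1 / 2 : ℝ) • ((v.2 : M) - star (v.2 : M)) := by
    intro v
    have h1 : (p : M) * v.2 = v.2 := v.2.2.1
    have h2 : (v.2 : M) * p = v.2 := v.2.2.2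
    have h3 : (p : M) * star (v.2 : M) = star (v.2 : M) := by
      have := congrArg star h2
      rwa [star_mul, p.star_eq] at this
    have h4 : star (v.2 : M) * p = star (v.2 : M) := by
      have := congrArg star h1
      rwa [star_mul, p.star_eq] at this
    have : (f v).2 = projB p ((1 / 2 : ℝ) • ((v.2 : M) - star (v.2 : M))) := by simp [f]
    rw [this, coe_projB_of_mem]
    · rw [mul_smul_comm, mul_sub, h1, h3]
    · rw [smul_mul_assoc, sub_mul, h2, h4]
  refine ⟨f.codRestrict (skewModel p) fun v => ?_, fun v => Subtype.ext (Prod.ext ?_ ?_)⟩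
  · rw [mem_skewModel, hf, star_smul, star_sub, star_star, star_trivial, ← smul_neg, neg_sub]
  · simp [f]
  · refine Subtype.ext ?_
    change ((f v).2 : M) = _
    rw [hf, mem_skewModel.1 v.2, sub_neg_eq_add, ← two_smul ℝ, smul_smul]
    norm_num

/-- The change of trivialization `(a, b) ↦ (a, σ* (a + σ b))`. -/
noncomputable def unitaryFwd (p : Proj M) (y : chartSpace p) : Model p →L[ℝ] Model p :=
  ContinuousLinearMap.inl ℝ (chartSpace p) (corner p) ∘L ContinuousLinearMap.fst ℝ _ _ +
  ContinuousLinearMap.inr ℝ (chartSpace p) (corner p) ∘L projB p ∘L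
    (lmulL (star ((p : M) + y)) ∘L (modelA p + lmulL ((p : M) + y) ∘L modelB p))

/-- The inverse `(a, c) ↦ (a, (σ* σ)⁻¹ (c - σ* a))` of `unitaryFwd`. -/
noncomputable def unitaryBwd (p : Proj M) (y : chartSpace p) : Model p →L[ℝ] Model p :=
  ContinuousLinearMap.inl ℝ (chartSpace p) (corner p) ∘L ContinuousLinearMap.fst ℝ _ _ +
  ContinuousLinearMap.inr ℝ (chartSpace p) (corner p) ∘L projB p ∘L
    (lmulL (Ring.inverse (star ((p : M) + y) * (p + y) + (1 - (p : M)))) ∘L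
      (modelB p - lmulL (star ((p : M) + y)) ∘L modelA p))

omit [PartialOrder M] [StarOrderedRing M] in
lemma unitaryFwd_fst (p : Proj M) (y : chartSpace p) (v : Model p) :
    (unitaryFwd p y v).1 = v.1 := by simp [unitaryFwd]

omit [PartialOrder M] [StarOrderedRing M] in
lemma unitaryBwd_fst (p : Proj M) (y : chartSpace p) (v : Model p) :
    (unitaryBwd p y v).1 = v.1 := by simp [unitaryBwd]

omit [PartialOrder M] [StarOrderedRing M] in
lemma proj_mul_star_sigma (p : Proj M) (y : chartSpace p) :
    (p : M) * star ((p : M) + y) = star ((p : M) + y) := by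
  have := congrArg star (sigma_mul p y)
  rwa [star_mul, p.star_eq] at this

omit [PartialOrder M] [StarOrderedRing M] in
lemma unitaryFwd_snd (p : Proj M) (y : chartSpace p) (v : Model p) :
    ((unitaryFwd p y v).2 : M) = star ((p : M) + y) * (v.1 + (p + y) * v.2) := by
  have h : (unitaryFwd p y v).2 = projB p (star ((p : M) + y) * (v.1 + (p + y) * v.2)) := by
    simp [unitaryFwd, mul_add]
  rw [h, coe_projB_of_mem]
  · rw [← mul_assoc, proj_mul_star_sigma]
  · have h2 : (v.2 : M) * p = v.2 := v.2.2.2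
    rw [mul_assoc, add_mul, chart_mul, mul_assoc, h2]

lemma unitaryBwd_snd (p : Proj M) (y : chartSpace p) (v : Model p) :
    ((unitaryBwd p y v).2 : M) = Ring.inverse (star ((p : M) + y) * (p + y) + (1 - (p : M))) *
      (v.2 - star ((p : M) + y) * v.1) := by
  have h : (unitaryBwd p y v).2 = projB p (Ring.inverse (star ((p : M) + y) * (p + y) +
      (1 - (p : M))) * (v.2 - star ((p : M) + y) * v.1)) := by
    simp [unitaryBwd, mul_sub]
  have h1 : (p : M) * v.2 = v.2 := v.2.2.1
  have h2 : (v.2 : M) * p = v.2 := v.2.2.2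
  rw [h, coe_projB_of_mem]
  · rw [← mul_assoc, LInv.inverse_comm (sigma_mem_LInv p y), mul_assoc, mul_sub, h1, ← mul_assoc,
      proj_mul_star_sigma]
  · rw [mul_assoc, sub_mul, h2, mul_assoc, chart_mul]

/-- The smooth change of trivialization that straightens the unitary algebroid. -/
noncomputable def unitaryEquiv (p : Proj M) (y : chartSpace p) : Model p ≃L[ℝ] Model p :=
  ContinuousLinearEquiv.equivOfInverse (unitaryFwd p y) (unitaryBwd p y)
    (fun v => by
      have h2 : (p : M) * v.2 = v.2 := v.2.2.1
      refine Prod.ext (by rw [unitaryBwd_fst, unitaryFwd_fst]) (Subtype.ext ?_)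
      rw [unitaryBwd_snd, unitaryFwd_fst, unitaryFwd_snd, mul_add _ (v.1 : M),
        add_sub_cancel_left,
        ← mul_assoc (star _), ← mul_assoc, LInv.inverse_mul (sigma_mem_LInv p y), h2])
    (fun v => by
      have h2 : (p : M) * v.2 = v.2 := v.2.2.1
      refine Prod.ext (by rw [unitaryFwd_fst, unitaryBwd_fst]) (Subtype.ext ?_)
      rw [unitaryFwd_snd, unitaryBwd_fst, unitaryBwd_snd, mul_add, ← mul_assoc (star _),
        ← mul_assoc, LInv.mul_inverse (sigma_mem_LInv p y), mul_sub, h2, ← mul_assoc (p : M),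
        proj_mul_star_sigma, add_sub_cancel])

omit [PartialOrder M] [StarOrderedRing M] in
lemma contDiff_unitaryFwd (p : Proj M) {n : ℕ∞ω} : ContDiff ℝ n (unitaryFwd p) := by
  have h1 := contDiff_lmulL.comp (contDiff_coe_sigma p (n := n))
  have h2 := contDiff_lmulL.comp (contDiff_star.comp (contDiff_coe_sigma p (n := n)))
  exact contDiff_const.add (contDiff_const.clm_comp (contDiff_const.clm_comp
    (h2.clm_comp (contDiff_const.add (h1.clm_comp contDiff_const)))))

lemma contDiff_unitaryBwd (p : Proj M) {n : ℕ∞ω} : ContDiff ℝ n (unitaryBwd p) := by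
  have h1 := contDiff_coe_sigma p (n := n)
  have h2 := contDiff_star.comp h1
  have h3 : ContDiff ℝ n fun y : chartSpace p =>
      Ring.inverse (star ((p : M) + y) * (p + y) + (1 - (p : M))) :=
    contDiff_iff_contDiffAt.2 fun y => contDiffAt_inverse
      ((h2.mul h1).add contDiff_const).contDiffAt (LInv.isUnit (sigma_mem_LInv p y))
  exact contDiff_const.add (contDiff_const.clm_comp (contDiff_const.clm_comp
    ((contDiff_lmulL.comp h3).clm_comp
      (contDiff_const.sub ((contDiff_lmulL.comp h2).clm_comp contDiff_const)))))

omit [PartialOrder M] [StarOrderedRing M] in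
-- Compressing `qx + x*q` to `σ*(·)σ` gives the sum of `σ*xσ` and its adjoint. Nothing is lost,
-- since `σpq = q` lets a further compression by `pq` undo it.
lemma IsChartSec.skew_iff {p q : Proj M} {σ x : M} (hs : IsChartSec p q σ) (hxq : x * q = x) :
    q * x + star x * q = 0 ↔ star (star σ * (x * σ)) = -(star σ * (x * σ)) := by
  have hσq : star σ * q = star σ := by
    have := congrArg star hs.left_mul
    rwa [star_mul, q.star_eq] at this
  have hqx : q * star x = star x := by
    have := congrArg star hxq
    rwa [star_mul, q.star_eq] at this
  have hqσ : q * p * star σ = q := by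
    have := congrArg star hs.mul_mul
    rwa [star_mul, star_mul, q.star_eq, p.star_eq, ← mul_assoc] at this
  have e1 : star σ * (q * x + star x * q) * σ = star σ * (x * σ) + star (star σ * (x * σ)) := by
    calc star σ * (q * x + star x * q) * σ
        = (star σ * q) * x * σ + star σ * star x * (q * σ) := by noncomm_ring
      _ = _ := by rw [hσq, hs.left_mul, star_mul, star_mul, star_star, mul_assoc]
  have e2 : q * p * (star σ * (x * σ) + star (star σ * (x * σ))) * (p * q) =
      q * x + star x * q := by
    rw [← e1]
    calc q * p * (star σ * (q * x + star x * q) * σ) * (p * q)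
        = (q * p * star σ) * (q * x + star x * q) * (σ * p * q) := by simp only [mul_assoc]
      _ = (q * q) * (x * q) + (q * star x) * (q * q) := by
          rw [hqσ, hs.mul_mul]; noncomm_ring
      _ = _ := by rw [hxq, hqx, q.mul_self]
  constructor
  · intro h
    rw [h, mul_zero, zero_mul] at e1
    exact eq_neg_of_add_eq_zero_right e1.symm
  · intro h
    rw [h, add_neg_cancel, mul_zero, zero_mul] at e2
    exact e2.symm

theorem isBanachSubbundle_algU (p₀ : Proj M) : IsBanachSubbundle p₀ (algA p₀) (algU p₀) := by
  refine ⟨fun q hq => by rw [algA_eq_univ hq]; exact Set.subset_univ _, fun p hp =>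
    ⟨skewModel p, unitaryEquiv p, closedComplemented_skewModel p, contDiff_unitaryFwd p,
      contDiff_unitaryBwd p, fun y => ?_⟩⟩
  have hq := chartInv_mem_orbit hp y
  rw [algA_eq_univ hq]
  ext x
  have hs := isChartSec_chartInv p y
  -- As `xσ = a + σb`, the new second coordinate is `σ*xσ`, so membership in the fixed subspace is
  -- the skewness of that element.
  have hT : ((unitaryEquiv p y (bundleCoord p y x)).2 : M) =
      star ((p : M) + y) * (x * (p + y)) := by
    rw [coordA_mul_sigma]
    exact unitaryFwd_snd p y (bundleCoord p y x)
  rw [mem_algU_iff hq]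
  simp only [Set.mem_ofPred_eq, Set.mem_univ, true_and]
  rw [mem_skewModel, hT]
  exact hs.skew_iff x.2

/-! ### Right translations -/

lemma injOn_rightTranslate {e : Proj M} {η : leftIdeal e} (hη : (η : M) ∈ LInv e)
    (S : Set (leftIdeal (lsupp (η : M)))) : Set.InjOn (rightTranslate η) S := by
  intro x _ x' _ h
  have h1 : (x : M) * η = x' * η := congrArg Subtype.val h
  have h2 := congrArg (· * ginv e (η : M)) h1
  simp only [mul_assoc, ← LInv.coe_lsupp hη] at h2
  exact Subtype.ext (x.2.symm.trans (h2.trans x'.2))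

/-- Both sides are full Banach spaces, and `v ↦ v * ginv e η` inverts the translation. -/
lemma bijOn_rightTranslate_algA {p₀ e : Proj M} (he : e ∈ orbit p₀) {η : leftIdeal e}
    (hη : (η : M) ∈ LInv e) : Set.BijOn (rightTranslate η) (algA p₀ (lsupp (η : M)))
      (tangentSet (sourceFibre (groupoidG p₀) e) η) := by
  rw [algA_eq_univ (LInv.lsupp_mem_orbit he hη), tangentSet_eq_univ (mem_nhds_sourceFibre he hη)]
  refine ⟨fun _ _ => trivial, injOn_rightTranslate hη _, fun v _ => ?_⟩
  have hv : (v : M) * e = v := v.2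
  refine ⟨⟨(v : M) * ginv e (η : M), ?_⟩, trivial, Subtype.ext ?_⟩
  · change (v : M) * ginv e (η : M) * (lsupp (η : M) : M) = _
    rw [LInv.coe_lsupp hη, mul_assoc, ← mul_assoc (ginv e (η : M)), LInv.ginv_mul hη,
      LInv.mul_ginv hη]
  · change (v : M) * ginv e (η : M) * η = v
    rw [mul_assoc, LInv.ginv_mul hη, hv]

lemma IsCurveIn.map {E F : Type*} [NormedAddCommGroup E] [NormedSpace ℝ E]
    [NormedAddCommGroup F] [NormedSpace ℝ F] {S : Set E} {T : Set F} {η v : E} {γ : ℝ → E}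
    (h : IsCurveIn S η v γ) (f : E →L[ℝ] F) (hST : Set.MapsTo f S T) :
    IsCurveIn T (f η) (f v) (f ∘ γ) := by
  obtain ⟨h1, h2, h3, h4⟩ := h
  refine ⟨f.contDiff.contDiffAt.comp (0 : ℝ) h1, congrArg f h2, ?_,
    f.hasFDerivAt.comp_hasDerivAt (0 : ℝ) h4⟩
  filter_upwards [h3] with t ht using hST ht

/-- Right multiplication by `η` and by `η*` are linear maps exchanging the source fibres of `U` over
`l(η)` and `e`. They carry curves to curves and undo each other, because `ηη* = l(η)` and `η*η = e`.
-/
lemma bijOn_rightTranslate_algU {p₀ e : Proj M} (he : e ∈ orbit p₀) {η : leftIdeal e}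
    (hη : η ∈ sourceFibre (groupoidU p₀) e) :
    Set.BijOn (rightTranslate η) (algU p₀ (lsupp (η : M)))
      (tangentSet (sourceFibre (groupoidU p₀) e) η) := by
  have hη' := (mem_sourceFibre_groupoidU_iff he).1 hη
  have hL : (η : M) ∈ LInv e := mem_LInv_of_star_mul_self η.2 hη'
  have hηe : (η : M) * e = η := η.2
  have hq := LInv.lsupp_mem_orbit he hL
  have hQ := lsupp_eq_mul_star η.2 hη'
  have hQη := LInv.lsupp_mul hL
  set q := lsupp (η : M) with hqdef
  have hηq : star (η : M) * q = star (η : M) := by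
    have := congrArg star hQη
    rwa [star_mul, q.star_eq] at this
  refine ⟨fun x hx => ?_, injOn_rightTranslate hL _, fun v hv => ?_⟩
  · obtain ⟨γ, hγ⟩ := hx
    have hmap : Set.MapsTo (rmulL q e (η : M)) (sourceFibre (groupoidU p₀) q)
        (sourceFibre (groupoidU p₀) e) := fun ζ hζ => by
      have hζ' := (mem_sourceFibre_groupoidU_iff hq).1 hζ
      refine (mem_sourceFibre_groupoidU_iff he).2 ?_
      rw [coe_rmulL hηe, star_mul, mul_assoc, ← mul_assoc (star (ζ : M)), hζ', hQη, hη']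
    have h1 := hγ.map _ hmap
    rw [show rmulL q e (η : M) (unit q) = η from Subtype.ext ((coe_rmulL hηe _).trans hQη)] at h1
    rw [rightTranslate_eq_rmulL]
    exact ⟨_, h1⟩
  · obtain ⟨γ, hγ⟩ := hv
    have hmap : Set.MapsTo (rmulL e q (star (η : M))) (sourceFibre (groupoidU p₀) e)
        (sourceFibre (groupoidU p₀) q) := fun ζ hζ => by
      have hζ' := (mem_sourceFibre_groupoidU_iff he).1 hζ
      refine (mem_sourceFibre_groupoidU_iff hq).2 ?_
      rw [coe_rmulL hηq, star_mul, star_star, mul_assoc, ← mul_assoc (star (ζ : M)), hζ',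
        ← mul_assoc, hηe, hQ]
    have h1 := hγ.map _ hmap
    rw [show rmulL e q (star (η : M)) η = unit q from
      Subtype.ext ((coe_rmulL hηq _).trans hQ.symm)] at h1
    refine ⟨rmulL e q (star (η : M)) v, ⟨_, h1⟩, Subtype.ext ?_⟩
    change (rmulL e q (star (η : M)) v : M) * η = v
    rw [coe_rmulL hηq, mul_assoc, hη']
    exact v.2

end Order

end Unitary

end WStarGroupoid

theorem mainTheorem4 {M : Type*} [CStarAlgebra M] [PartialOrder M] [StarOrderedRing M]
    [WStarAlgebra M] (p₀ : Proj M) :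
    -- the base manifold and the ambient Banach-Lie algebroid
    IsBaseAtlas p₀ ∧
    IsBanachBundle p₀ (algA p₀) ∧
    IsLieAlgebroid p₀ (algA p₀) ∧
    -- the unitary algebroid is a real Banach subbundle
    IsBanachSubbundle p₀ (algA p₀) (algU p₀) ∧
    -- its sections are closed under the bracket
    (∀ X Y, IsSection p₀ (algU p₀) X →
      IsSection p₀ (algU p₀) Y →
      IsSection p₀ (algU p₀) (bracket X Y)) ∧
    -- with the restricted bracket and anchor it is a transitive Lie algebroid
    IsLieAlgebroid p₀ (algU p₀) ∧
    IsTransitive p₀ (algU p₀) ∧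
    -- the restricted bracket is the one of the groupoid of partial isometries
    (∀ X Y, IsSection p₀ (algU p₀) X →
      IsSection p₀ (algU p₀) Y → ∀ q ∈ orbit p₀,
      IsBracketOf (groupoidU p₀) X Y q
        (bracket X Y q)) ∧
    -- the anchor of the groupoid of partial isometries is the restriction of the tangent map of `l`
    (∀ p ∈ orbit p₀, ∀ q ∈ chartDom p,
      HasFDerivAt (fun η : leftIdeal q =>
        chart p (lsupp (η : M)))
        (anchor p q) (unit q) ∧
      ∀ x ∈ algU p₀ q,
        IsAnchorOf (groupoidU p₀) p q x
          (anchor p q x)) ∧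
    -- in the chart at `p` the anchor sends a section to its component `a_p`
    (∀ X, IsSection p₀ (algU p₀) X →
      ∀ p ∈ orbit p₀, ContDiff ℝ ∞ (anchorField p X) ∧
        ∀ y : chartSpace p, anchorField p X y =
          coordA p y (X (chartInv p y))) ∧
    -- right translation identifies the two algebroids with `TP₀/G₀` and `TP₀ᵘ/U₀`,
    -- the bracket with that of the invariant vector fields, and the anchor with `Tl`
    (∀ η ∈ sourceFibre (groupoidG p₀) p₀,
      Set.BijOn (rightTranslate η)
        (algA p₀ (lsupp (η : M)))
        (tangentSet
          (sourceFibre (groupoidG p₀) p₀) η) ∧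
      (∀ X Y, IsSection p₀ (algA p₀) X →
        IsSection p₀ (algA p₀) Y →
        VectorField.lieBracket ℝ (rightInv p₀ X) (rightInv p₀ Y) η =
          rightInv p₀ (bracket X Y) η) ∧
      ∀ p ∈ orbit p₀, lsupp (η : M) ∈ chartDom p →
        ∃ D : leftIdeal p₀ →L[ℝ] chartSpace p,
          HasFDerivAt (fun ξ : leftIdeal p₀ =>
            chart p (lsupp (ξ : M))) D η ∧
          ∀ x ∈ algA p₀ (lsupp (η : M)),
            D (rightTranslate η x) =
              anchor p (lsupp (η : M)) x) ∧
    (∀ η ∈ sourceFibre (groupoidU p₀) p₀,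
      Set.BijOn (rightTranslate η)
        (algU p₀ (lsupp (η : M)))
        (tangentSet
          (sourceFibre (groupoidU p₀) p₀) η)) := by
  have hp₀ := self_mem_orbit p₀
  refine ⟨isBaseAtlas p₀, isBanachBundle_algA p₀, isLieAlgebroid_algA p₀,
    isBanachSubbundle_algU p₀, (isLieAlgebroid_algU p₀).bracket_mem, isLieAlgebroid_algU p₀,
    isTransitive_algU p₀,
    fun X Y hX hY q hq => isBracketOf_bracket hX.isSmoothFamily hY.isSmoothFamily hq _,
    fun p _ q hq => ⟨hasFDerivAt_anchor hq, fun x _ => isAnchorOf_anchor hq _ x⟩,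
    fun X hX p hp => ⟨hX.contDiff_anchorField hp, anchorField_apply p X⟩,
    fun η hη => ?_, fun η hη => bijOn_rightTranslate_algU hp₀ hη⟩
  have hL := (mem_sourceFibre_groupoidG_iff hp₀).1 hη
  refine ⟨bijOn_rightTranslate_algA hp₀ hL,
    fun X Y hX hY => lieBracket_rightInv hX.isSmoothFamily hY.isSmoothFamily hp₀ hL,
    fun p _ hd => ⟨_, (differentiableAt_chart_lsupp hL hd).hasFDerivAt, fun x _ => ?_⟩⟩
  rw [rightTranslate_eq, fderiv_chart_lsupp hL hd, anchor_apply hd]
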